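/- \textbf{Setting.} Let $n,m\ge 1$, let $\Omega\subset\mathbb R^n$ be a bounded domain, and let $Q:\Omega\to\mathbb R$ be Lebesgue measurable with $Q_{min}\le Q\le Q_{max}$ a.e. in $\Omega$, where $0<Q_{min}\le Q_{max}$ are constants. Let $\mathbf g\in H^1(\Omega;\mathbb R^m)$ have components $g_i\ge 0$ a.e. in $\Omega$, and let $\mathcal A$ be the set of all $\mathbf v\in H^1(\Omega;\mathbb R^m)$ with $\mathbf v=\mathbf g$ on $\partial\Omega$ (i.e. $\mathbf v-\mathbf g\in H^1_0(\Omega;\mathbb R^m)$) and $v_i\ge 0$ a.e. in $\Omega$ for $i=1,\dots,m$. Put $$J(\mathbf v)=\int_\Omega\bigl(|\nabla\mathbf v|^2+Q^2\chi_{\{|\mathbf v|>0\}}\bigr)\,dx,\qquad d(\mathbf u,\mathbf v)=\|\mathbf u-\mathbf v\|_{H^1(\Omega;\mathbb R^m)}+\|\chi_{\{|\mathbf u|>0\}}-\chi_{\{|\mathbf v|>0\}}\|_{L^1(\Omega)}.$$ A map $\mathbf u\in\mathcal A$ is an absolute minimizer if $J(\mathbf u)\le J(\mathbf v)$ for all $\mathbf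 v\in\mathcal A$, and a local minimizer if for some $\epsilon>0$ this holds for all $\mathbf v\in\mathcal A$ with $d(\mathbf u,\mathbf v)<\epsilon$. The components of such a $\mathbf u$ are subharmonic, and pointwise values refer to the version $u_i(x)=\lim_{s\to0+}\frac1{|B_s(x)|}\int_{B_s(x)}u_i\,dy$, $x\in\Omega$. \textbf{Theorem (optimal linear nondegeneracy).} For each dimension $n$ and each $0<\rho<1$ there is a constant $c=c(\rho)>0$, depending only on $\rho$ (and the fixed dimension $n$), such that the following holds for all $m,\Omega,Q_{min},Q_{max},Q,\mathbf g$ as above. (a) If $\mathbf u$ is an absolute minimizer, then for every ball $B_r(x)\subset\Omega$, $r>0$, and every $0<\rho<1$, $$\overline{B_{\rho r}(x)}\cap\{|\mathbf u|>0\}\neq\emptyset\quad\Longrightarrow\quad \sup_{B_r(x)}|\mathbf u|\ \ge\ c(\rho)\,Q_{min}\,r .$$ (b) If $\mathbf u$ is a local minimizer, then there are $r_0>0$ and $\rho_0>0$ (which may depend on $\mathbf u$ and the data) such that the same implication holds for every ball $B_r(x)\subset\Omega$ with $0<r\le r_0$ and every $0<\rho<1$, where in the case $n=2$ additionally $\rho\le\rho_0$.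 The supremum is allowed to be $+\infty$. -/

import Mathlib

open MeasureTheory Filter Topology
open scoped ContDiff

noncomputable section

namespace VectorBernoulli

/-- `G` is the weak gradient of the scalar function `f` in the open set `Ω`:
`∫_Ω f ∇φ = - ∫_Ω φ G` for all test functions `φ ∈ C_c^∞(Ω)`. It is used only for
`f` and `G` in `L²(Ω)`, so that both integrals converge. -/
def IsWeakGradient {n : ℕ} (Ω : Set (EuclideanSpace ℝ (Fin n)))
    (f : EuclideanSpace ℝ (Fin n) → ℝ)
    (G : EuclideanSpace ℝ (Fin n) → EuclideanSpace ℝ (Fin n)) : Prop :=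
  ∀ φ : EuclideanSpace ℝ (Fin n) → ℝ, ContDiff ℝ ∞ φ → HasCompactSupport φ → tsupport φ ⊆ Ω →
    ∫ x in Ω, f x • gradient φ x = - ∫ x in Ω, φ x • G x

/-- An element of `H¹(Ω; ℝᵐ)`: a square integrable function on `Ω` together with the
square integrable weak gradients of its components (these are unique a.e. in `Ω`).
Values outside `Ω` play no role. -/
structure SobolevMap {n : ℕ} (Ω : Set (EuclideanSpace ℝ (Fin n))) (m : ℕ) where
  /-- the function -/
  val : EuclideanSpace ℝ (Fin n) → EuclideanSpace ℝ (Fin m)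
  /-- the weak gradients of the components -/
  grad : Fin m → EuclideanSpace ℝ (Fin n) → EuclideanSpace ℝ (Fin n)
  memLp_val : MemLp val 2 (volume.restrict Ω)
  memLp_grad : ∀ i, MemLp (grad i) 2 (volume.restrict Ω)
  isWeakGradient : ∀ i, IsWeakGradient Ω (fun x => val x i) (grad i)

variable {n m : ℕ} {Ω : Set (EuclideanSpace ℝ (Fin n))}

/-- The `H¹(Ω; ℝᵐ)` norm of a map with values `f` and component gradients `G`. -/
def h1Norm (Ω : Set (EuclideanSpace ℝ (Fin n)))
    (f : EuclideanSpace ℝ (Fin n) → EuclideanSpace ℝ (Fin m))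
    (G : Fin m → EuclideanSpace ℝ (Fin n) → EuclideanSpace ℝ (Fin n)) : ℝ :=
  Real.sqrt (∫ x in Ω, (‖f x‖ ^ 2 + ∑ i, ‖G i x‖ ^ 2))

/-- `u = g` on `∂Ω`, that is `u - g ∈ H¹₀(Ω; ℝᵐ)`, the closure of `C_c^∞(Ω; ℝᵐ)` in `H¹`. -/
def EqOnBoundary (u g : SobolevMap Ω m) : Prop :=
  ∀ ε : ℝ, 0 < ε → ∃ φ : EuclideanSpace ℝ (Fin n) → EuclideanSpace ℝ (Fin m),
    ContDiff ℝ ∞ φ ∧ HasCompactSupport φ ∧ tsupport φ ⊆ Ω ∧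
    h1Norm Ω (fun x => u.val x - g.val x - φ x)
      (fun i x => u.grad i x - g.grad i x - gradient (fun y => φ y i) x) < ε

/-- All components are nonnegative a.e. in `Ω`. -/
def NonnegAE (u : SobolevMap Ω m) : Prop :=
  ∀ i, ∀ᵐ x ∂(volume.restrict Ω), 0 ≤ u.val x i

/-- The admissible class `𝒜` for the boundary data `g`. -/
def Admissible (g v : SobolevMap Ω m) : Prop :=
  EqOnBoundary v g ∧ NonnegAE v

/-- The characteristic function of `{|u| > 0}`. -/
def chi (u : SobolevMap Ω m) : EuclideanSpace ℝ (Fin n) → ℝ :=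
  Set.indicator {x | 0 < ‖u.val x‖} (fun _ => 1)

/-- The functional `J(u) = ∫_Ω (|∇u|² + Q² χ_{|u|>0})`. -/
def energy (Q : EuclideanSpace ℝ (Fin n) → ℝ) (u : SobolevMap Ω m) : ℝ :=
  ∫ x in Ω, ((∑ i, ‖u.grad i x‖ ^ 2) + Q x ^ 2 * chi u x)

/-- The metric `d(u, v) = ‖u - v‖_{H¹} + ‖χ_{|u|>0} - χ_{|v|>0}‖_{L¹}`. -/
def metricD (u v : SobolevMap Ω m) : ℝ :=
  h1Norm Ω (fun x => u.val x - v.val x) (fun i x => u.grad i x - v.grad i x)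
    + ∫ x in Ω, |chi u x - chi v x|

/-- Absolute minimizers of `J` in the admissible class. -/
def IsAbsoluteMinimizer (Q : EuclideanSpace ℝ (Fin n) → ℝ) (g u : SobolevMap Ω m) : Prop :=
  Admissible g u ∧ ∀ v : SobolevMap Ω m, Admissible g v → energy Q u ≤ energy Q v

/-- Local minimizers of `J` in the admissible class, with respect to the metric `d`. -/
def IsLocalMinimizer (Q : EuclideanSpace ℝ (Fin n) → ℝ) (g u : SobolevMap Ω m) : Prop :=
  Admissible g u ∧ ∃ ε : ℝ, 0 < ε ∧
    ∀ v : SobolevMap Ω m, Admissible g v → metricD u v < ε → energy Q u ≤ energy Q v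

/-- The pointwise version of `u`: `u_i(x) = lim_{s → 0+} ⨍_{B_s(x)} u_i`. For a (local) minimizer
the limit exists at every `x ∈ Ω`, since the `u_i` are then subharmonic, and it is equal
to `u_i` a.e. in `Ω`. -/
def version (u : SobolevMap Ω m) (x : EuclideanSpace ℝ (Fin n)) : EuclideanSpace ℝ (Fin m) :=
  WithLp.toLp 2 fun i =>
    limUnder (𝓝[>] (0 : ℝ)) fun s => ⨍ y in Metric.ball x s, u.val y i

end VectorBernoulli

end

/-! The only competitors are `(1 - φ) u` with a smooth cutoff `φ ≤ 1`. As long as `φ ≠ 1` the set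
`{|u| > 0}` does not change, so replacing `φ` by `t φ` with small `t` of either sign makes the first
variation vanish: `∫ φ |∇u|² + ∑ uᵢ ∇uᵢ · ∇φ = 0` for every test function `φ`. This identity is used
twice.

Applied to `φ (2 - φ)`, it removes every derivative of `u` from the comparison with `(1 - φ) u`. If
`φ = 1` on the smaller ball, then `Qmin² |{|u| > 0} ∩ B_s| ≤ ∫ |u|² |∇φ|²` remains
(`weight_le_of_energy_le`, `integral_chi_le`). Applied to `φ ≥ 0`, it says that `|u|²` is weakly
subharmonic, so `|u|²` satisfies a mean value inequality (`exists_mean_value_const`,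
`exists_normSq_mean_value_const`).

If `|u| ≤ M` on `B_R`, then `∫ |u|²` over the smaller ball is at most `M²` times the measure of
`{|u| > 0}`, and that measure is itself of order `M²`. So `|u|²` is bounded by a multiple of `M⁴`
slightly further inside (`exists_decay_const`). The gain in homogeneity drives a De Giorgi type
iteration over shrinking balls: if `|u| ≤ c(ρ) Qmin r` on `B_r`, then `u = 0` on a ball strictly
larger than `B_{ρr}` (`exists_vanishing_const`). The theorem is the contrapositive.

For local minimizers the competitors must be close to `u` in the metric `d`. The cutoffs in use
satisfy `|u| |∇φ| ≤ Qmin`, so `d(u, (1 - φ) u)` tends to zero with the radius, uniformly in the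
centre (`exists_radius_metricD_lt`). -/

noncomputable section

namespace VectorBernoulli

/-! ### Gradients of differentiable functions. -/

section GradientCalculus

variable {F : Type*} [NormedAddCommGroup F] [InnerProductSpace ℝ F] [CompleteSpace F]

theorem gradient_mul {f g : F → ℝ} {x : F} (hf : DifferentiableAt ℝ f x)
    (hg : DifferentiableAt ℝ g x) :
    gradient (fun y => f y * g y) x = f x • gradient g x + g x • gradient f x := by
  simp [gradient, fderiv_fun_mul hf hg]

theorem gradient_sub {f g : F → ℝ} {x : F} (hf : DifferentiableAt ℝ f x)
    (hg : DifferentiableAt ℝ g x) :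
    gradient (fun y => f y - g y) x = gradient f x - gradient g x := by
  simp [gradient, fderiv_fun_sub hf hg]

theorem gradient_const_mul {f : F → ℝ} {x : F} (hf : DifferentiableAt ℝ f x) (c : ℝ) :
    gradient (fun y => c * f y) x = c • gradient f x := by
  simp [gradient, fderiv_const_mul hf c]

theorem gradient_comp {h : ℝ → ℝ} {f : F → ℝ} {x : F} {h' : ℝ} (hh : HasDerivAt h h' (f x))
    (hf : DifferentiableAt ℝ f x) :
    gradient (fun y => h (f y)) x = h' • gradient f x := by
  have : fderiv ℝ (fun y => h (f y)) x = h' • fderiv ℝ f x :=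
    (hh.comp_hasFDerivAt x hf.hasFDerivAt).fderiv
  simp [gradient, this]

theorem gradient_norm_sub_sq (y x : F) :
    gradient (fun z => ‖z - y‖ ^ 2) x = (2 : ℝ) • (x - y) := by
  have h : HasFDerivAt (fun z => ‖z - y‖ ^ 2) _ x := ((hasFDerivAt_id x).sub_const y).norm_sq
  rw [gradient, h.fderiv, LinearIsometryEquiv.symm_apply_eq]
  ext v
  simp [two_mul]

theorem continuous_gradient {f : F → ℝ} (hf : ContDiff ℝ ∞ f) : Continuous (gradient f) :=
  (InnerProductSpace.toDual ℝ F).symm.continuous.comp (hf.continuous_fderiv (by simp))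

theorem norm_gradient (f : F → ℝ) (x : F) : ‖gradient f x‖ = ‖fderiv ℝ f x‖ := by
  rw [← toDual_gradient, LinearIsometryEquiv.norm_map]

theorem gradient_eq_zero_of_notMem_tsupport {f : F → ℝ} {x : F} (hx : x ∉ tsupport f) :
    gradient f x = 0 := by
  rw [← norm_eq_zero, norm_gradient, norm_eq_zero]
  by_contra h
  exact hx (support_fderiv_subset ℝ h)

theorem hasCompactSupport_gradient {f : F → ℝ} (hc : HasCompactSupport f) :
    HasCompactSupport (gradient f) :=
  HasCompactSupport.intro hc fun _ hx => gradient_eq_zero_of_notMem_tsupport hx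

end GradientCalculus

/-! ### Integrability of products and multiplication by test functions. -/

section L2

variable {α : Type*} [MeasurableSpace α] {μ : Measure α}
  {F : Type*} [NormedAddCommGroup F] [InnerProductSpace ℝ F]

theorem integrable_smul_of_memLp_two {f : α → ℝ} {g : α → F} (hf : MemLp f 2 μ)
    (hg : MemLp g 2 μ) : Integrable (fun x => f x • g x) μ :=
  memLp_one_iff_integrable.1 (hg.smul hf)

theorem integrable_norm_sq {F : Type*} [NormedAddCommGroup F] {f : α → F} (hf : MemLp f 2 μ) :
    Integrable (fun x => ‖f x‖ ^ 2) μ :=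
  hf.integrable_norm_pow (p := 2) (by norm_num)

end L2

variable {n m : ℕ} {Ω : Set (EuclideanSpace ℝ (Fin n))}

local notation "E" => EuclideanSpace ℝ (Fin n)

section Bounded

variable {F : Type*} [NormedAddCommGroup F]

theorem memLp_top_of_hasCompactSupport {φ : E → F} (hφ : Continuous φ) (hc : HasCompactSupport φ)
    (μ : Measure E) : MemLp φ ⊤ μ := by
  obtain ⟨C, hC⟩ := hc.exists_bound_of_continuous hφ
  exact memLp_top_of_bound hφ.aestronglyMeasurable C (Eventually.of_forall hC)

theorem memLp_smul_left [NormedSpace ℝ F] {φ : E → ℝ} (hφ : Continuous φ) (hc : HasCompactSupport φ)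
    {μ : Measure E} {p : ENNReal} {f : E → F} (hf : MemLp f p μ) :
    MemLp (fun x => φ x • f x) p μ :=
  hf.smul (memLp_top_of_hasCompactSupport hφ hc μ)

theorem memLp_smul_right [NormedSpace ℝ F] {φ : E → F} (hφ : Continuous φ) (hc : HasCompactSupport φ)
    {μ : Measure E} {p : ENNReal} {f : E → ℝ} (hf : MemLp f p μ) :
    MemLp (fun x => f x • φ x) p μ :=
  (memLp_top_of_hasCompactSupport hφ hc μ).smul hf

theorem memLp_of_hasCompactSupport {φ : E → F} (hφ : Continuous φ) (hc : HasCompactSupport φ)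
    (s : Set E) (p : ENNReal) : MemLp φ p (volume.restrict s) :=
  (hφ.memLp_of_hasCompactSupport hc).restrict s

end Bounded

theorem gradient_smooth_mul {φ ψ : E → ℝ} (hφ : ContDiff ℝ ∞ φ) (hψ : ContDiff ℝ ∞ ψ) (x : E) :
    gradient (fun y => φ y * ψ y) x = φ x • gradient ψ x + ψ x • gradient φ x :=
  gradient_mul (hφ.differentiable (by simp) x) (hψ.differentiable (by simp) x)

theorem integrable_smul_gradient {f : E → ℝ} (hf : MemLp f 2 (volume.restrict Ω)) {ψ : E → ℝ}
    (hψ : ContDiff ℝ ∞ ψ) (hc : HasCompactSupport ψ) :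
    IntegrableOn (fun x => f x • gradient ψ x) Ω :=
  integrable_smul_of_memLp_two hf
    (memLp_of_hasCompactSupport (continuous_gradient hψ) (hasCompactSupport_gradient hc) _ _)

theorem integrable_test_smul {G : E → E} (hG : MemLp G 2 (volume.restrict Ω)) {ψ : E → ℝ}
    (hψ : ContDiff ℝ ∞ ψ) (hc : HasCompactSupport ψ) :
    IntegrableOn (fun x => ψ x • G x) Ω :=
  integrable_smul_of_memLp_two (memLp_of_hasCompactSupport hψ.continuous hc _ _) hG

/-! ### Calculus of weak gradients. -/

theorem IsWeakGradient.sub {f₁ f₂ : E → ℝ} {G₁ G₂ : E → E}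
    (hf₁ : MemLp f₁ 2 (volume.restrict Ω)) (hG₁ : MemLp G₁ 2 (volume.restrict Ω))
    (h₁ : IsWeakGradient Ω f₁ G₁)
    (hf₂ : MemLp f₂ 2 (volume.restrict Ω)) (hG₂ : MemLp G₂ 2 (volume.restrict Ω))
    (h₂ : IsWeakGradient Ω f₂ G₂) :
    IsWeakGradient Ω (fun x => f₁ x - f₂ x) (fun x => G₁ x - G₂ x) := by
  intro ψ hψ hc hs
  simp only [sub_smul, smul_sub]
  rw [integral_sub (integrable_smul_gradient hf₁ hψ hc) (integrable_smul_gradient hf₂ hψ hc),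
    integral_sub (integrable_test_smul hG₁ hψ hc) (integrable_test_smul hG₂ hψ hc),
    h₁ ψ hψ hc hs, h₂ ψ hψ hc hs]
  abel

/-- Product rule; if the support of `φ` lies in `Ω`, the test function need not have its support
in `Ω`. -/
theorem IsWeakGradient.integral_mul {f : E → ℝ} {G : E → E}
    (hf : MemLp f 2 (volume.restrict Ω)) (hG : MemLp G 2 (volume.restrict Ω))
    (h : IsWeakGradient Ω f G) {φ ψ : E → ℝ} (hφ : ContDiff ℝ ∞ φ) (hψ : ContDiff ℝ ∞ ψ)
    (hφc : HasCompactSupport φ) (hψc : HasCompactSupport ψ)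
    (hs : tsupport (fun x => φ x * ψ x) ⊆ Ω) :
    ∫ x in Ω, (φ x * f x) • gradient ψ x =
      - ∫ x in Ω, ψ x • (φ x • G x + f x • gradient φ x) := by
  have hm : ContDiff ℝ ∞ fun x => φ x * ψ x := hφ.mul hψ
  have hmc : HasCompactSupport fun x => φ x * ψ x := hφc.mul_right
  -- The product `φ ψ` is the test function, so only its support has to lie in `Ω`.
  have key := h _ hm hmc hs
  have i1 : IntegrableOn (fun x => (φ x * f x) • gradient ψ x) Ω :=
    integrable_smul_gradient (memLp_smul_left hφ.continuous hφc hf) hψ hψc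
  have i2 : IntegrableOn (fun x => ψ x • f x • gradient φ x) Ω :=
    integrable_test_smul
      (memLp_smul_right (continuous_gradient hφ) (hasCompactSupport_gradient hφc) hf) hψ hψc
  have i3 : IntegrableOn (fun x => ψ x • φ x • G x) Ω :=
    integrable_test_smul (memLp_smul_left hφ.continuous hφc hG) hψ hψc
  have e1 : ∫ x in Ω, f x • gradient (fun y => φ y * ψ y) x =
      (∫ x in Ω, (φ x * f x) • gradient ψ x) + ∫ x in Ω, ψ x • f x • gradient φ x := by
    rw [← integral_add i1 i2]
    congr 1 with x : 1
    rw [gradient_smooth_mul hφ hψ]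
    module
  have e2 : ∫ x in Ω, (φ x * ψ x) • G x = ∫ x in Ω, ψ x • φ x • G x := by
    congr 1 with x : 1
    module
  simp only [smul_add]
  rw [integral_add i3 i2, ← e2]
  rw [e1] at key
  rw [neg_add, ← key]
  abel

theorem IsWeakGradient.mul {f : E → ℝ} {G : E → E}
    (hf : MemLp f 2 (volume.restrict Ω)) (hG : MemLp G 2 (volume.restrict Ω))
    (h : IsWeakGradient Ω f G) {φ : E → ℝ} (hφ : ContDiff ℝ ∞ φ) (hφc : HasCompactSupport φ) :
    IsWeakGradient Ω (fun x => φ x * f x) (fun x => φ x • G x + f x • gradient φ x) :=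
  fun _ hψ hc hs => h.integral_mul hf hG hφ hψ hφc hc ((tsupport_mul_subset_right).trans hs)

theorem memLp_weakGradient_mul {f : E → ℝ} {G : E → E}
    (hf : MemLp f 2 (volume.restrict Ω)) (hG : MemLp G 2 (volume.restrict Ω))
    {φ : E → ℝ} (hφ : ContDiff ℝ ∞ φ) (hφc : HasCompactSupport φ) :
    MemLp (fun x => φ x • G x + f x • gradient φ x) 2 (volume.restrict Ω) :=
  (memLp_smul_left hφ.continuous hφc hG).add
    (memLp_smul_right (continuous_gradient hφ) (hasCompactSupport_gradient hφc) hf)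

/-! ### The competitors `(1 - φ) u` and the expansion of their energy. -/

theorem SobolevMap.memLp_coord (u : SobolevMap Ω m) (i : Fin m) :
    MemLp (fun x => u.val x i) 2 (volume.restrict Ω) :=
  (EuclideanSpace.proj (𝕜 := ℝ) i).comp_memLp' u.memLp_val

/-- The Sobolev map `(1 - φ) u` for a test function `φ`. -/
def SobolevMap.mulCut (u : SobolevMap Ω m) {φ : E → ℝ} (hφ : ContDiff ℝ ∞ φ)
    (hc : HasCompactSupport φ) : SobolevMap Ω m where
  val x := u.val x - φ x • u.val x
  grad i x := u.grad i x - (φ x • u.grad i x + u.val x i • gradient φ x)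
  memLp_val := u.memLp_val.sub (memLp_smul_left hφ.continuous hc u.memLp_val)
  memLp_grad i := (u.memLp_grad i).sub
    (memLp_weakGradient_mul (u.memLp_coord i) (u.memLp_grad i) hφ hc)
  isWeakGradient i := (u.isWeakGradient i).sub (u.memLp_coord i) (u.memLp_grad i)
    (memLp_smul_left hφ.continuous hc (u.memLp_coord i))
    (memLp_weakGradient_mul (u.memLp_coord i) (u.memLp_grad i) hφ hc)
    ((u.isWeakGradient i).mul (u.memLp_coord i) (u.memLp_grad i) hφ hc)

/-- The energy density `|∇u|²`. -/
def SobolevMap.gradSq (u : SobolevMap Ω m) (x : E) : ℝ := ∑ i, ‖u.grad i x‖ ^ 2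

/-- The vector field `∑ uᵢ ∇uᵢ`, which is half of the gradient of `|u|²`. -/
def SobolevMap.cross (u : SobolevMap Ω m) (x : E) : E := ∑ i, u.val x i • u.grad i x

/-- Half of the derivative of the Dirichlet energy in the direction `φ u`. -/
def SobolevMap.firstVar (u : SobolevMap Ω m) (φ : E → ℝ) : ℝ :=
  ∫ x in Ω, (φ x * u.gradSq x + inner ℝ (u.cross x) (gradient φ x))

/-- The Dirichlet energy of `φ u`. -/
def SobolevMap.secondVar (u : SobolevMap Ω m) (φ : E → ℝ) : ℝ :=
  ∫ x in Ω, (φ x ^ 2 * u.gradSq x + 2 * φ x * inner ℝ (u.cross x) (gradient φ x)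
    + ‖u.val x‖ ^ 2 * ‖gradient φ x‖ ^ 2)

theorem SobolevMap.integrable_gradSq (u : SobolevMap Ω m) : IntegrableOn u.gradSq Ω :=
  integrable_finsetSum _ fun i _ => integrable_norm_sq (u.memLp_grad i)

theorem SobolevMap.integrable_cross (u : SobolevMap Ω m) : IntegrableOn u.cross Ω :=
  integrable_finsetSum _ fun i _ => integrable_smul_of_memLp_two (u.memLp_coord i) (u.memLp_grad i)

theorem integrable_mul_of_hasCompactSupport {φ f : E → ℝ} (hφ : Continuous φ)
    (hc : HasCompactSupport φ) (hf : IntegrableOn f Ω) :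
    IntegrableOn (fun x => φ x * f x) Ω :=
  memLp_one_iff_integrable.1 (memLp_smul_left hφ hc (memLp_one_iff_integrable.2 hf))

theorem integrable_inner_of_hasCompactSupport {φ f : E → E} (hφ : Continuous φ)
    (hc : HasCompactSupport φ) (hf : IntegrableOn f Ω) :
    IntegrableOn (fun x => inner ℝ (f x) (φ x)) Ω := by
  obtain ⟨C, hC⟩ := hc.exists_bound_of_continuous hφ
  refine (hf.norm.const_mul C).mono (hf.1.inner hφ.aestronglyMeasurable) ?_
  refine Eventually.of_forall fun x => ?_
  calc ‖inner ℝ (f x) (φ x)‖ ≤ ‖f x‖ * ‖φ x‖ := norm_inner_le_norm _ _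
    _ ≤ ‖f x‖ * C := by gcongr; exact hC x
    _ = C * ‖f x‖ := mul_comm _ _
    _ ≤ ‖C * ‖f x‖‖ := le_abs_self _

theorem SobolevMap.integrable_inner_cross (u : SobolevMap Ω m) {φ : E → ℝ}
    (hφ : ContDiff ℝ ∞ φ) (hc : HasCompactSupport φ) :
    IntegrableOn (fun x => inner ℝ (u.cross x) (gradient φ x)) Ω :=
  integrable_inner_of_hasCompactSupport (continuous_gradient hφ) (hasCompactSupport_gradient hc)
    u.integrable_cross

theorem SobolevMap.integrable_normSq_mul (u : SobolevMap Ω m) {φ : E → ℝ}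
    (hφ : ContDiff ℝ ∞ φ) (hc : HasCompactSupport φ) :
    IntegrableOn (fun x => ‖u.val x‖ ^ 2 * ‖gradient φ x‖ ^ 2) Ω := by
  have h := integrable_mul_of_hasCompactSupport (φ := fun x => ‖gradient φ x‖ ^ 2)
    ((continuous_gradient hφ).norm.pow 2)
    ((hasCompactSupport_gradient hc).norm.comp_left (g := fun t : ℝ => t ^ 2) (by norm_num))
    (integrable_norm_sq u.memLp_val)
  simpa only [mul_comm] using h

theorem SobolevMap.integrable_firstVar (u : SobolevMap Ω m) {φ : E → ℝ}
    (hφ : ContDiff ℝ ∞ φ) (hc : HasCompactSupport φ) :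
    IntegrableOn (fun x => φ x * u.gradSq x + inner ℝ (u.cross x) (gradient φ x)) Ω :=
  (integrable_mul_of_hasCompactSupport hφ.continuous hc u.integrable_gradSq).add
    (u.integrable_inner_cross hφ hc)

theorem SobolevMap.integrable_secondVar (u : SobolevMap Ω m) {φ : E → ℝ}
    (hφ : ContDiff ℝ ∞ φ) (hc : HasCompactSupport φ) :
    IntegrableOn (fun x => φ x ^ 2 * u.gradSq x + 2 * φ x * inner ℝ (u.cross x) (gradient φ x)
      + ‖u.val x‖ ^ 2 * ‖gradient φ x‖ ^ 2) Ω := by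
  refine ((integrable_mul_of_hasCompactSupport (φ := fun x => φ x ^ 2) (hφ.continuous.pow 2)
    (hc.comp_left (g := fun t : ℝ => t ^ 2) (by norm_num)) u.integrable_gradSq).add ?_).add
    (u.integrable_normSq_mul hφ hc)
  exact integrable_mul_of_hasCompactSupport (φ := fun x => 2 * φ x)
    (continuous_const.mul hφ.continuous) (hc.mul_left) (u.integrable_inner_cross hφ hc)

theorem SobolevMap.gradSq_mulCut (u : SobolevMap Ω m) {φ : E → ℝ} (hφ : ContDiff ℝ ∞ φ)
    (hc : HasCompactSupport φ) (x : E) :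
    (u.mulCut hφ hc).gradSq x = u.gradSq x
      - 2 * (φ x * u.gradSq x + inner ℝ (u.cross x) (gradient φ x))
      + (φ x ^ 2 * u.gradSq x + 2 * φ x * inner ℝ (u.cross x) (gradient φ x)
        + ‖u.val x‖ ^ 2 * ‖gradient φ x‖ ^ 2) := by
  have h : ∀ i, ‖(u.mulCut hφ hc).grad i x‖ ^ 2 = ‖u.grad i x‖ ^ 2
      - 2 * (φ x * ‖u.grad i x‖ ^ 2 + u.val x i * inner ℝ (u.grad i x) (gradient φ x))
      + (φ x ^ 2 * ‖u.grad i x‖ ^ 2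
        + 2 * φ x * (u.val x i * inner ℝ (u.grad i x) (gradient φ x))
        + u.val x i ^ 2 * ‖gradient φ x‖ ^ 2) := by
    intro i
    simp only [SobolevMap.mulCut]
    simp only [← real_inner_self_eq_norm_sq, inner_sub_left, inner_sub_right, inner_add_left,
      inner_add_right, real_inner_smul_left, real_inner_smul_right,
      real_inner_comm (u.grad i x) (gradient φ x)]
    ring
  simp only [SobolevMap.gradSq, SobolevMap.cross, h, sum_inner, real_inner_smul_left,
    EuclideanSpace.real_norm_sq_eq (u.val x), Finset.sum_add_distrib, Finset.sum_sub_distrib,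
    Finset.mul_sum, Finset.sum_mul, mul_add]

theorem chi_nonneg (u : SobolevMap Ω m) (x : E) : 0 ≤ chi u x :=
  Set.indicator_nonneg (fun _ _ => zero_le_one) x

theorem chi_le_one (u : SobolevMap Ω m) (x : E) : chi u x ≤ 1 :=
  Set.indicator_le_self' (s := {x | 0 < ‖u.val x‖}) (f := fun _ => (1 : ℝ))
    (fun _ _ => zero_le_one) x

theorem chi_of_ne_zero {u : SobolevMap Ω m} {x : E} (h : u.val x ≠ 0) : chi u x = 1 := by
  simp [chi, h]

theorem chi_of_eq_zero {u : SobolevMap Ω m} {x : E} (h : u.val x = 0) : chi u x = 0 := by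
  simp [chi, h]

theorem aestronglyMeasurable_chi (u : SobolevMap Ω m) :
    AEStronglyMeasurable (chi u) (volume.restrict Ω) := by
  have h : Measurable (Set.indicator {v : EuclideanSpace ℝ (Fin m) | 0 < ‖v‖}
      (fun _ => (1 : ℝ))) :=
    measurable_const.indicator (measurableSet_lt measurable_const measurable_norm)
  exact (h.comp_aemeasurable u.memLp_val.1.aemeasurable).aestronglyMeasurable

theorem integrable_weight_chi {Q : E → ℝ} (hQ : IntegrableOn (fun x => Q x ^ 2) Ω)
    (u : SobolevMap Ω m) : IntegrableOn (fun x => Q x ^ 2 * chi u x) Ω := by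
  refine Integrable.mono hQ (hQ.1.mul (aestronglyMeasurable_chi u)) (Eventually.of_forall fun x => ?_)
  rw [norm_mul]
  refine mul_le_of_le_one_right (norm_nonneg _) ?_
  rw [Real.norm_of_nonneg (chi_nonneg u x)]
  exact chi_le_one u x

theorem integral_sub_add {α : Type*} [MeasurableSpace α] {μ : Measure α} {f g h : α → ℝ}
    (hf : Integrable f μ) (hg : Integrable g μ) (hh : Integrable h μ) :
    ∫ x, (f x - g x + h x) ∂μ = ∫ x, f x ∂μ - ∫ x, g x ∂μ + ∫ x, h x ∂μ := by
  rw [integral_add (f := fun x => f x - g x) (hf.sub hg) hh, integral_sub hf hg]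

theorem integral_sub_add_sub {α : Type*} [MeasurableSpace α] {μ : Measure α} {f g h k : α → ℝ}
    (hf : Integrable f μ) (hg : Integrable g μ) (hh : Integrable h μ) (hk : Integrable k μ) :
    ∫ x, (f x - g x + h x - k x) ∂μ =
      ∫ x, f x ∂μ - ∫ x, g x ∂μ + ∫ x, h x ∂μ - ∫ x, k x ∂μ := by
  rw [integral_sub (f := fun x => f x - g x + h x) ((hf.sub hg).add hh) hk,
    integral_sub_add hf hg hh]

/-- The Dirichlet part is exactly quadratic in `φ`; the measure term is the only nonpolynomial
contribution. -/
theorem energy_mulCut {Q : E → ℝ} (hQ : IntegrableOn (fun x => Q x ^ 2) Ω)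
    (u : SobolevMap Ω m) {φ : E → ℝ} (hφ : ContDiff ℝ ∞ φ) (hc : HasCompactSupport φ) :
    energy Q (u.mulCut hφ hc) = energy Q u - 2 * u.firstVar φ + u.secondVar φ
      - ∫ x in Ω, Q x ^ 2 * (chi u x - chi (u.mulCut hφ hc) x) := by
  have i0 : IntegrableOn (fun x => u.gradSq x + Q x ^ 2 * chi u x) Ω :=
    u.integrable_gradSq.add (integrable_weight_chi hQ u)
  have i1 := (u.integrable_firstVar hφ hc).const_mul 2
  have i2 := u.integrable_secondVar hφ hc
  have i3 : IntegrableOn (fun x => Q x ^ 2 * (chi u x - chi (u.mulCut hφ hc) x)) Ω := by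
    simp only [mul_sub]
    exact (integrable_weight_chi hQ u).sub (integrable_weight_chi hQ _)
  rw [SobolevMap.firstVar, SobolevMap.secondVar, ← integral_const_mul]
  change ∫ x in Ω, ((u.mulCut hφ hc).gradSq x + _) = (∫ x in Ω, (u.gradSq x + _)) - _ + _ - _
  rw [← integral_sub_add_sub i0 i1 i2 i3]
  congr 1 with x : 1
  rw [u.gradSq_mulCut hφ hc]
  ring

theorem gradient_smooth_const_mul {φ : E → ℝ} (hφ : ContDiff ℝ ∞ φ) (t : ℝ) (x : E) :
    gradient (fun y => t * φ y) x = t • gradient φ x :=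
  gradient_const_mul (hφ.differentiable (by simp) x) t

theorem SobolevMap.firstVar_const_mul (u : SobolevMap Ω m) {φ : E → ℝ} (hφ : ContDiff ℝ ∞ φ)
    (t : ℝ) : u.firstVar (fun x => t * φ x) = t * u.firstVar φ := by
  simp only [SobolevMap.firstVar, gradient_smooth_const_mul hφ, real_inner_smul_right]
  rw [← integral_const_mul]
  congr 1 with x : 1
  ring

theorem SobolevMap.secondVar_const_mul (u : SobolevMap Ω m) {φ : E → ℝ} (hφ : ContDiff ℝ ∞ φ)
    (t : ℝ) : u.secondVar (fun x => t * φ x) = t ^ 2 * u.secondVar φ := by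
  simp only [SobolevMap.secondVar, gradient_smooth_const_mul hφ, real_inner_smul_right, norm_smul,
    mul_pow, Real.norm_eq_abs, sq_abs]
  rw [← integral_const_mul]
  congr 1 with x : 1
  ring

/-- A nonzero factor `1 - φ x` cannot create or destroy zeros; positivity is lost only where `φ =
1`. -/
theorem chi_mulCut_of_ne_one (u : SobolevMap Ω m) {φ : E → ℝ} (hφ : ContDiff ℝ ∞ φ)
    (hc : HasCompactSupport φ) {x : E} (hx : φ x ≠ 1) : chi (u.mulCut hφ hc) x = chi u x := by
  have e : (u.mulCut hφ hc).val x = (1 - φ x) • u.val x := by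
    simp only [SobolevMap.mulCut]; module
  by_cases h : u.val x = 0
  · rw [chi_of_eq_zero h, chi_of_eq_zero (by rw [e, h, smul_zero])]
  · rw [chi_of_ne_zero h, chi_of_ne_zero]
    rw [e]
    exact smul_ne_zero (sub_ne_zero.2 (Ne.symm hx)) h

theorem chi_mulCut_of_eq_one (u : SobolevMap Ω m) {φ : E → ℝ} (hφ : ContDiff ℝ ∞ φ)
    (hc : HasCompactSupport φ) {x : E} (hx : φ x = 1) : chi (u.mulCut hφ hc) x = 0 :=
  chi_of_eq_zero (by simp [SobolevMap.mulCut, hx])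

theorem chi_mulCut_le (u : SobolevMap Ω m) {φ : E → ℝ} (hφ : ContDiff ℝ ∞ φ)
    (hc : HasCompactSupport φ) (x : E) : chi (u.mulCut hφ hc) x ≤ chi u x := by
  by_cases hx : φ x = 1
  · rw [chi_mulCut_of_eq_one u hφ hc hx]
    exact chi_nonneg u x
  · rw [chi_mulCut_of_ne_one u hφ hc hx]

/-- If `a ≠ 0`, choose `t` with the sign of `a` and so small that the linear term dominates the
quadratic one. -/
theorem eq_zero_of_linear_le_quadratic {a b δ : ℝ} (hδ : 0 < δ)
    (h : ∀ t : ℝ, |t| < δ → 0 ≤ t ^ 2 * b - 2 * (t * a)) : a = 0 := by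
  by_contra ha
  have hK : 0 < |b| + 1 := by positivity
  have ha' : 0 < |a| := abs_pos.2 ha
  obtain ⟨s, hs0, hs1, hs2⟩ : ∃ s, 0 < s ∧ s < δ ∧ s * (|b| + 1) < |a| := by
    refine ⟨min (δ / 2) (|a| / (2 * (|b| + 1))), by positivity,
      (min_le_left _ _).trans_lt (by linarith), ?_⟩
    calc _ ≤ |a| / (2 * (|b| + 1)) * (|b| + 1) := by gcongr; exact min_le_right _ _
      _ = |a| / 2 := by field_simp
      _ < |a| := by linarith
  have hb := le_abs_self b
  have key : 0 ≤ s ^ 2 * b - 2 * (s * |a|) := by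
    rcases abs_cases a with ⟨e, _⟩ | ⟨e, _⟩
    · rw [e]; exact h s (by rwa [abs_of_pos hs0])
    · rw [e]
      have := h (-s) (by rwa [abs_neg, abs_of_pos hs0])
      linarith
  nlinarith

/-- Along the family `(1 - t φ) u` the set `{|u| > 0}` does not change, so that minimality gives
a linear identity. -/
theorem SobolevMap.firstVar_eq_zero {Q : E → ℝ} (hQ : IntegrableOn (fun x => Q x ^ 2) Ω)
    (u : SobolevMap Ω m) {φ : E → ℝ} (hφ : ContDiff ℝ ∞ φ) (hc : HasCompactSupport φ)
    {δ : ℝ} (hδ : 0 < δ)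
    (hmin : ∀ t : ℝ, |t| < δ → (∀ x, |t * φ x| < 1) →
      energy Q u ≤ energy Q (u.mulCut (contDiff_const.mul hφ : ContDiff ℝ ∞ fun x => t * φ x)
        hc.mul_left)) :
    u.firstVar φ = 0 := by
  obtain ⟨C, hC⟩ := hc.exists_bound_of_continuous hφ.continuous
  have hC0 : 0 ≤ C := (norm_nonneg _).trans (hC 0)
  -- The bound `1 / (C + 1)` keeps `|t φ| < 1`, so `1 - t φ` never vanishes.
  refine eq_zero_of_linear_le_quadratic (b := u.secondVar φ)
    (lt_min hδ (by positivity : 0 < 1 / (C + 1))) fun t ht => ?_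
  have hsm : ∀ x, |t * φ x| < 1 := by
    intro x
    rw [abs_mul]
    calc |t| * |φ x| ≤ |t| * (C + 1) := by gcongr; exact (hC x).trans (by linarith)
      _ < 1 / (C + 1) * (C + 1) := by gcongr; exact ht.trans_le (min_le_right _ _)
      _ = 1 := by field_simp
  have h := hmin t (ht.trans_le (min_le_left _ _)) hsm
  rw [energy_mulCut hQ, u.firstVar_const_mul hφ, u.secondVar_const_mul hφ] at h
  have hz : ∫ x in Ω, Q x ^ 2 * (chi u x - chi (u.mulCut
      (contDiff_const.mul hφ : ContDiff ℝ ∞ fun x => t * φ x) hc.mul_left) x) = 0 := by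
    refine integral_eq_zero_of_ae (Eventually.of_forall fun x => ?_)
    have : t * φ x ≠ 1 := fun e => by simpa [e] using hsm x
    simp only [chi_mulCut_of_ne_one u (φ := fun x => t * φ x) (contDiff_const.mul hφ)
      hc.mul_left this, sub_self, mul_zero, Pi.zero_apply]
  rw [hz] at h
  linarith

/-- If the first variation vanishes, then the comparison of `u` with `(1 - φ) u` reduces to zeroth
order terms. -/
theorem SobolevMap.weight_le_of_energy_le {Q : E → ℝ} (hQ : IntegrableOn (fun x => Q x ^ 2) Ω)
    (u : SobolevMap Ω m) {φ : E → ℝ} (hφ : ContDiff ℝ ∞ φ) (hc : HasCompactSupport φ)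
    (hvar : u.firstVar (fun x => φ x * (2 - φ x)) = 0)
    (hmin : energy Q u ≤ energy Q (u.mulCut hφ hc)) :
    ∫ x in Ω, Q x ^ 2 * (chi u x - chi (u.mulCut hφ hc) x) ≤
      ∫ x in Ω, ‖u.val x‖ ^ 2 * ‖gradient φ x‖ ^ 2 := by
  rw [energy_mulCut hQ] at hmin
  have hg : ∀ x, gradient (fun y => φ y * (2 - φ y)) x = (2 * (1 - φ x)) • gradient φ x := by
    intro x
    have hd := hφ.differentiable (by simp) x
    rw [gradient_mul (g := fun y => 2 - φ y) hd ((differentiableAt_const _).sub hd),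
      gradient_sub (f := fun _ => 2) (differentiableAt_const _) hd]
    simp only [gradient_fun_const]
    module
  -- Since `φ (2 - φ) = 1 - (1 - φ)²` has gradient `2 (1 - φ) ∇φ`, all terms containing `∇u` cancel.
  have key : u.secondVar φ - 2 * u.firstVar φ + u.firstVar (fun x => φ x * (2 - φ x)) =
      ∫ x in Ω, ‖u.val x‖ ^ 2 * ‖gradient φ x‖ ^ 2 := by
    have i1 := (u.integrable_firstVar hφ hc).const_mul 2
    have i2 := u.integrable_secondVar hφ hc
    have i3 := u.integrable_firstVar (φ := fun x => φ x * (2 - φ x))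
      (hφ.mul (contDiff_const.sub hφ)) hc.mul_right
    rw [SobolevMap.firstVar, SobolevMap.secondVar, SobolevMap.firstVar, ← integral_const_mul,
      ← integral_sub_add i2 i1 i3]
    congr 1 with x : 1
    simp only [hg, real_inner_smul_right]
    ring
  linarith

/-! ### Mollification: `φ u` lies in `H¹₀`, and the weak gradient of `|u|²`. -/

section Mollification

variable {V : Type*} [NormedAddCommGroup V] [NormedSpace ℝ V] [CompleteSpace V]

/-- Continuity of translations in `L²`, read off from the continuous action of the additive group on
`Lp`. -/
theorem exists_eLpNorm_translate_sub_le {V : Type*} [NormedAddCommGroup V] {F : E → V} (hF : MemLp F 2 volume) {ε : ENNReal}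
    (hε : ε ≠ 0) : ∃ δ > 0, ∀ t : E, ‖t‖ < δ → eLpNorm (fun x => F (x - t) - F x) 2 volume ≤ ε := by
  have hc : Continuous fun t : E => (DomAddAct.mk (-t)) +ᵥ hF.toLp := by
    have : Fact ((2 : ENNReal) ≠ ⊤) := ⟨by norm_num⟩
    exact (DomAddAct.continuous_mk.comp continuous_neg).vadd continuous_const
  have h0 : (DomAddAct.mk (-(0 : E))) +ᵥ hF.toLp = hF.toLp := by simp
  have ht := hc.tendsto 0
  rw [h0, EMetric.tendsto_nhds] at ht
  obtain ⟨δ, hδ, hb⟩ := Metric.eventually_nhds_iff.1 (ht ε (pos_iff_ne_zero.2 hε))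
  refine ⟨δ, hδ, fun t htδ => ?_⟩
  have h1 := (hb (y := t) (by simpa using htδ)).le
  rw [DomAddAct.mk_vadd_toLp, Lp.edist_toLp_toLp] at h1
  have e : (fun x => F (x - t) - F x) = (fun x => F (-t +ᵥ x)) - F := by
    funext x
    simp [sub_eq_neg_add]
  rwa [e]

theorem exists_eLpNorm_mollify_sub_le {F : E → V} (hF : MemLp F 2 volume) {ε : ENNReal}
    (hε : ε ≠ 0) : ∃ δ > 0, ∀ ρ : ContDiffBump (0 : E), ρ.rOut < δ →
      eLpNorm (fun x => (convolution (ρ.normed volume) F (ContinuousLinearMap.lsmul ℝ ℝ) volume) x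
        - F x) 2 volume ≤ ε := by
  wlog hm : StronglyMeasurable F generalizing F
  · obtain ⟨δ, hδ, h⟩ := this (hF.ae_eq hF.1.ae_eq_mk) hF.1.stronglyMeasurable_mk
    refine ⟨δ, hδ, fun ρ hρ => ?_⟩
    refine le_of_eq_of_le (eLpNorm_congr_ae ?_) (h ρ hρ)
    rw [convolution_congr _ (EventuallyEq.refl _ _) hF.1.ae_eq_mk]
    filter_upwards [hF.1.ae_eq_mk] with x hx
    rw [← hx]
  obtain ⟨δ, hδ, h⟩ := exists_eLpNorm_translate_sub_le hF hε
  refine ⟨δ, hδ, fun ρ hρ => ?_⟩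
  -- The mollifier is viewed as a probability measure `ν`, so the error is an average of translation
  -- differences `F (x - t) - F x`.
  set ν : Measure E := volume.withDensity fun t => ENNReal.ofReal (ρ.normed volume t) with hν
  have hρm : Measurable fun t => ENNReal.ofReal (ρ.normed volume t) :=
    (ρ.continuous_normed).measurable.ennreal_ofReal
  have : IsProbabilityMeasure ν := by
    refine ⟨?_⟩
    rw [hν, withDensity_apply _ MeasurableSet.univ, Measure.restrict_univ,
      ← ofReal_integral_eq_lintegral_ofReal ρ.integrable_normed
        (Eventually.of_forall ρ.nonneg_normed), ρ.integral_normed, ENNReal.ofReal_one]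
  have hsupp : ∀ᵐ t ∂ν, ‖t‖ < δ := by
    rw [hν, ae_withDensity_iff hρm]
    refine Eventually.of_forall fun t ht => ?_
    have : t ∈ Function.support (ρ.normed volume) := fun e => ht (by simp [e])
    rw [ρ.support_normed_eq, mem_ball_zero_iff] at this
    exact this.trans hρ
  have hli : LocallyIntegrable F volume := hF.locallyIntegrable (by norm_num)
  have hconv : ∀ x, (convolution (ρ.normed volume) F (ContinuousLinearMap.lsmul ℝ ℝ) volume) x
      - F x = ∫ t, (F (x - t) - F x) ∂ν := by
    intro x
    have hex : Integrable (fun t => ρ.normed volume t • F (x - t)) volume :=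
      ρ.hasCompactSupport_normed.convolutionExists_left (ContinuousLinearMap.lsmul ℝ ℝ)
        ρ.continuous_normed hli x
    have hr : ∀ t, (ENNReal.ofReal (ρ.normed volume t)).toReal = ρ.normed volume t := fun t =>
      ENNReal.toReal_ofReal (ρ.nonneg_normed t)
    have hi : Integrable (fun t => F (x - t)) ν := by
      rw [hν, integrable_withDensity_iff_integrable_smul' hρm (by simp)]
      simpa only [hr] using hex
    rw [integral_sub hi (integrable_const _), integral_const, probReal_univ, one_smul, hν,
      integral_withDensity_eq_integral_toReal_smul hρm (by simp)]
    simp only [hr]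
    rfl
  have hjm : Measurable fun p : E × E => ‖F (p.1 - p.2) - F p.1‖ₑ ^ (2 : ℝ) := by
    have h1 : StronglyMeasurable fun p : E × E => F (p.1 - p.2) - F p.1 :=
      (hm.comp_measurable (measurable_fst.sub measurable_snd)).sub (hm.comp_measurable measurable_fst)
    exact h1.enorm.pow_const _
  -- Jensen's inequality, in the form `L¹ ≤ L²` for the probability measure `ν`; Tonelli then
  -- reduces the claim to single translations.
  have hpt : ∀ x, ‖∫ t, (F (x - t) - F x) ∂ν‖ₑ ^ (2 : ℝ) ≤
      ∫⁻ t, ‖F (x - t) - F x‖ₑ ^ (2 : ℝ) ∂ν := by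
    intro x
    have hs : AEStronglyMeasurable (fun t => F (x - t) - F x) ν :=
      ((hm.comp_measurable (measurable_const.sub measurable_id)).sub
        stronglyMeasurable_const).aestronglyMeasurable
    calc ‖∫ t, (F (x - t) - F x) ∂ν‖ₑ ^ (2 : ℝ)
        ≤ (eLpNorm (fun t => F (x - t) - F x) 1 ν) ^ (2 : ℝ) := by
          gcongr
          rw [eLpNorm_one_eq_lintegral_enorm]
          exact enorm_integral_le_lintegral_enorm _
      _ ≤ (eLpNorm (fun t => F (x - t) - F x) 2 ν) ^ (2 : ℝ) := by
          gcongr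
          exact eLpNorm_le_eLpNorm_of_exponent_le (by norm_num) hs
      _ = _ := by
          rw [eLpNorm_eq_lintegral_rpow_enorm_toReal (by norm_num) (by norm_num),
            ← ENNReal.rpow_mul]
          norm_num
  have h2 : ∀ f : E → V, eLpNorm f 2 volume ^ (2 : ℝ) = ∫⁻ x, ‖f x‖ₑ ^ (2 : ℝ) := by
    intro f
    rw [eLpNorm_eq_lintegral_rpow_enorm_toReal (by norm_num) (by norm_num), ← ENNReal.rpow_mul]
    norm_num
  rw [← ENNReal.rpow_le_rpow_iff (z := 2) (by norm_num), h2]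
  calc _ ≤ ∫⁻ x, ∫⁻ t, ‖F (x - t) - F x‖ₑ ^ (2 : ℝ) ∂ν := by
        refine lintegral_mono fun x => ?_
        simp only [hconv]
        exact hpt x
    _ = ∫⁻ t, (∫⁻ x, ‖F (x - t) - F x‖ₑ ^ (2 : ℝ)) ∂ν := lintegral_lintegral_swap hjm.aemeasurable
    _ ≤ ∫⁻ _, ε ^ (2 : ℝ) ∂ν := by
        refine lintegral_mono_ae ?_
        filter_upwards [hsupp] with t ht
        rw [← h2]
        gcongr
        exact h t ht
    _ = ε ^ (2 : ℝ) := by simp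

end Mollification

/-- The derivative falls on the mollifier, and the weak gradient identity is tested with `t ↦ ρ (x -
t)`; the reflection supplies the sign. -/
theorem gradient_mollify {F : E → ℝ} {H : E → E} (hF : LocallyIntegrable F volume)
    (h : IsWeakGradient Set.univ F H) {ρ : E → ℝ} (hρ : ContDiff ℝ ∞ ρ)
    (hc : HasCompactSupport ρ) (x : E) :
    gradient (convolution ρ F (ContinuousLinearMap.lsmul ℝ ℝ) volume) x =
      convolution ρ H (ContinuousLinearMap.lsmul ℝ ℝ) volume x := by
  have hd := hc.hasFDerivAt_convolution_left (ContinuousLinearMap.lsmul ℝ ℝ) (hρ.of_le (by simp))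
    hF x
  rw [gradient, hd.fderiv, LinearIsometryEquiv.symm_apply_eq, convolution_eq_swap,
    convolution_lsmul_swap]
  have hg : ∀ t, gradient (fun t => ρ (x - t)) t = - gradient ρ (x - t) := by
    intro t
    have h1 := (hρ.differentiable (by simp) (x - t)).hasFDerivAt
    have h2 : HasFDerivAt (fun t => ρ (x - t)) _ t :=
      h1.comp t ((hasFDerivAt_id t).const_sub x)
    rw [gradient, h2.fderiv, gradient, ← map_neg]
    congr 1
    ext v
    simp
  have hψ : ContDiff ℝ ∞ fun t => ρ (x - t) := hρ.comp (contDiff_const.sub contDiff_id)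
  have hψc : HasCompactSupport fun t => ρ (x - t) :=
    hc.comp_homeomorph (Homeomorph.subLeft x)
  have key := h _ hψ hψc (Set.subset_univ _)
  simp only [hg, Measure.restrict_univ, smul_neg, integral_neg, neg_inj] at key
  rw [← key, ← LinearIsometryEquiv.coe_toContinuousLinearEquiv]
  rw [← ContinuousLinearEquiv.integral_comp_comm]
  congr 1 with t : 1
  ext v
  simp [ContinuousLinearMap.precompL, mul_comm]

theorem exists_tsupport_mollify_subset (hΩ : IsOpen Ω) {K : Set E} (hK : IsCompact K)
    (hKΩ : K ⊆ Ω) : ∃ δ > 0, ∀ (F : E → ℝ), (∀ x ∉ K, F x = 0) →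
      ∀ ρ : ContDiffBump (0 : E), ρ.rOut < δ →
        HasCompactSupport (convolution (ρ.normed volume) F (ContinuousLinearMap.lsmul ℝ ℝ) volume)
        ∧ tsupport (convolution (ρ.normed volume) F (ContinuousLinearMap.lsmul ℝ ℝ) volume) ⊆ Ω := by
  obtain ⟨δ, hδ, h⟩ := hK.exists_cthickening_subset_open hΩ hKΩ
  refine ⟨δ, hδ, fun F hF ρ hρ => ?_⟩
  have hs : tsupport (convolution (ρ.normed volume) F (ContinuousLinearMap.lsmul ℝ ℝ) volume) ⊆
      Metric.cthickening δ K := by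
    refine closure_minimal ?_ Metric.isClosed_cthickening
    refine (support_convolution_subset (ContinuousLinearMap.lsmul ℝ ℝ)).trans ?_
    rintro _ ⟨a, ha, b, hb, rfl⟩
    rw [ρ.support_normed_eq, mem_ball_zero_iff] at ha
    have hbK : b ∈ K := by
      by_contra hb'
      exact hb (hF b hb')
    refine Metric.mem_cthickening_of_dist_le _ b δ K hbK ?_
    simpa using (ha.trans hρ).le
  exact ⟨hK.cthickening.of_isClosed_subset (isClosed_tsupport _) hs, hs.trans h⟩

/-- A compactly supported localization `φ f` of a function `f ∈ H¹(Ω)` belongs to `H¹₀(Ω)`. -/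
theorem IsWeakGradient.exists_test_approx (hΩ : IsOpen Ω) {f : E → ℝ} {G : E → E}
    (hf : MemLp f 2 (volume.restrict Ω)) (hG : MemLp G 2 (volume.restrict Ω))
    (h : IsWeakGradient Ω f G) {φ : E → ℝ} (hφ : ContDiff ℝ ∞ φ) (hφc : HasCompactSupport φ)
    (hs : tsupport φ ⊆ Ω) {ε : ENNReal} (hε : ε ≠ 0) :
    ∃ ψ : E → ℝ, ContDiff ℝ ∞ ψ ∧ HasCompactSupport ψ ∧ tsupport ψ ⊆ Ω ∧
      eLpNorm (fun x => φ x * f x - ψ x) 2 (volume.restrict Ω) ≤ ε ∧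
      eLpNorm (fun x => φ x • G x + f x • gradient φ x - gradient ψ x) 2 (volume.restrict Ω)
        ≤ ε := by
  set F : E → ℝ := Ω.indicator fun x => φ x * f x with hF
  set H : E → E := Ω.indicator fun x => φ x • G x + f x • gradient φ x with hH
  have hF2 : MemLp F 2 volume := (memLp_indicator_iff_restrict hΩ.measurableSet).2
    (memLp_smul_left hφ.continuous hφc hf)
  have hH2 : MemLp H 2 volume := (memLp_indicator_iff_restrict hΩ.measurableSet).2
    (memLp_weakGradient_mul hf hG hφ hφc)
  -- Extension by zero produces no boundary term, because `φ` is supported in `Ω`; here the product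
  -- rule is needed for `ψ` not supported in `Ω`.
  have hw : IsWeakGradient Set.univ F H := by
    intro ψ hψ hψc _
    have key := h.integral_mul hf hG hφ hψ hφc hψc ((tsupport_mul_subset_left).trans hs)
    rw [Measure.restrict_univ]
    calc ∫ x, F x • gradient ψ x
        = ∫ x, Ω.indicator (fun x => (φ x * f x) • gradient ψ x) x := by
          congr 1 with x : 1
          by_cases hx : x ∈ Ω <;> simp [hF, hx]
      _ = - ∫ x, Ω.indicator (fun x => ψ x • (φ x • G x + f x • gradient φ x)) x := by
          rw [integral_indicator hΩ.measurableSet, key, integral_indicator hΩ.measurableSet]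
      _ = - ∫ x, ψ x • H x := by
          congr 2 with x : 1
          by_cases hx : x ∈ Ω <;> simp [hH, hx]
  obtain ⟨δ₁, hδ₁, h₁⟩ := exists_eLpNorm_mollify_sub_le hF2 hε
  obtain ⟨δ₂, hδ₂, h₂⟩ := exists_eLpNorm_mollify_sub_le hH2 hε
  obtain ⟨δ₃, hδ₃, h₃⟩ := exists_tsupport_mollify_subset hΩ hφc hs
  obtain ⟨r, hr0, hr⟩ : ∃ r, 0 < r ∧ r < min δ₁ (min δ₂ δ₃) :=
    exists_between (lt_min hδ₁ (lt_min hδ₂ hδ₃))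
  have hr1 : r < δ₁ := hr.trans_le (min_le_left _ _)
  have hr2 : r < δ₂ := hr.trans_le ((min_le_right _ _).trans (min_le_left _ _))
  have hr3 : r < δ₃ := hr.trans_le ((min_le_right _ _).trans (min_le_right _ _))
  let ρ : ContDiffBump (0 : E) := ⟨r / 2, r, by linarith, by linarith⟩
  have hFK : ∀ x ∉ tsupport φ, F x = 0 := by
    intro x hx
    by_cases hxΩ : x ∈ Ω <;> simp [hF, hxΩ, image_eq_zero_of_notMem_tsupport hx]
  have hli : LocallyIntegrable F volume := hF2.locallyIntegrable (by norm_num)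
  have hρ : ContDiff ℝ ∞ (ρ.normed volume) := ρ.contDiff_normed
  obtain ⟨hc, hsub⟩ := h₃ F hFK ρ hr3
  refine ⟨_, ρ.hasCompactSupport_normed.contDiff_convolution_left
    (ContinuousLinearMap.lsmul ℝ ℝ) hρ hli, hc, hsub, ?_, ?_⟩
  · calc _ = eLpNorm (fun x => F x - convolution (ρ.normed volume) F
          (ContinuousLinearMap.lsmul ℝ ℝ) volume x) 2 (volume.restrict Ω) := by
          refine eLpNorm_congr_ae ?_
          filter_upwards [ae_restrict_mem hΩ.measurableSet] with x hx
          simp [hF, hx]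
      _ ≤ _ := eLpNorm_restrict_le _ _ _ _
      _ ≤ ε := le_of_eq_of_le (eLpNorm_sub_comm _ _ _ _) (h₁ ρ hr1)
  · calc _ = eLpNorm (fun x => H x - convolution (ρ.normed volume) H
          (ContinuousLinearMap.lsmul ℝ ℝ) volume x) 2 (volume.restrict Ω) := by
          refine eLpNorm_congr_ae ?_
          filter_upwards [ae_restrict_mem hΩ.measurableSet] with x hx
          rw [gradient_mollify hli hw hρ ρ.hasCompactSupport_normed]
          simp [hH, hx]
      _ ≤ _ := eLpNorm_restrict_le _ _ _ _
      _ ≤ ε := le_of_eq_of_le (eLpNorm_sub_comm _ _ _ _) (h₂ ρ hr2)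

theorem enorm_integral_smul_le {α : Type*} [MeasurableSpace α] {μ : Measure α} {V : Type*}
    [NormedAddCommGroup V] [NormedSpace ℝ V] {f : α → ℝ} {g : α → V}
    (hf : AEStronglyMeasurable f μ) (hg : AEStronglyMeasurable g μ) :
    ‖∫ x, f x • g x ∂μ‖ₑ ≤ eLpNorm f 2 μ * eLpNorm g 2 μ := by
  refine (enorm_integral_le_lintegral_enorm _).trans ?_
  rw [← eLpNorm_one_eq_lintegral_enorm]
  exact eLpNorm_smul_le_mul_eLpNorm hg hf

/-- The weak gradient of `f²` is `2 f G`. -/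
theorem IsWeakGradient.integral_sq_smul_gradient (hΩ : IsOpen Ω) {f : E → ℝ} {G : E → E}
    (hf : MemLp f 2 (volume.restrict Ω)) (hG : MemLp G 2 (volume.restrict Ω))
    (h : IsWeakGradient Ω f G) {φ : E → ℝ} (hφ : ContDiff ℝ ∞ φ) (hφc : HasCompactSupport φ)
    (hs : tsupport φ ⊆ Ω) :
    ∫ x in Ω, f x ^ 2 • gradient φ x = - (2 : ℝ) • ∫ x in Ω, φ x • f x • G x := by
  have m1 : MemLp (fun x => φ x * f x) 2 (volume.restrict Ω) :=
    memLp_smul_left hφ.continuous hφc hf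
  have m2 := memLp_weakGradient_mul hf hG hφ hφc
  -- This is the weak gradient identity of `f` with `φ f` in place of a test function; it follows by
  -- approximating `φ f` in `H¹` by test functions `ψ`.
  have key : (∫ x in Ω, f x • (φ x • G x + f x • gradient φ x)) +
      ∫ x in Ω, (φ x * f x) • G x = 0 := by
    rw [← enorm_eq_zero]
    have hfin : eLpNorm f 2 (volume.restrict Ω) + eLpNorm G 2 (volume.restrict Ω) ≠ ⊤ :=
      ENNReal.add_ne_top.2 ⟨hf.2.ne, hG.2.ne⟩
    by_contra hne
    obtain ⟨ε, hε0, hε⟩ : ∃ ε : ENNReal, ε ≠ 0 ∧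
        (eLpNorm f 2 (volume.restrict Ω) + eLpNorm G 2 (volume.restrict Ω)) * ε <
        ‖(∫ x in Ω, f x • (φ x • G x + f x • gradient φ x)) +
          ∫ x in Ω, (φ x * f x) • G x‖ₑ := by
      have ht : Tendsto (fun ε : ENNReal => (eLpNorm f 2 (volume.restrict Ω) +
          eLpNorm G 2 (volume.restrict Ω)) * ε) (𝓝[>] 0) (𝓝 0) := by
        have := (ENNReal.continuous_const_mul hfin).tendsto 0
        rw [mul_zero] at this
        exact this.mono_left nhdsWithin_le_nhds
      obtain ⟨ε, h1, h2⟩ := ((ht.eventually_lt_const (pos_iff_ne_zero.2 hne)).and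
        self_mem_nhdsWithin).exists
      exact ⟨ε, (pos_iff_ne_zero.1 h2), h1⟩
    obtain ⟨ψ, hψ, hψc, hψs, e1, e2⟩ := h.exists_test_approx hΩ hf hG hφ hφc hs hε0
    have n1 : MemLp (gradient ψ) 2 (volume.restrict Ω) :=
      memLp_of_hasCompactSupport (continuous_gradient hψ) (hasCompactSupport_gradient hψc) _ _
    have n2 : MemLp ψ 2 (volume.restrict Ω) := memLp_of_hasCompactSupport hψ.continuous hψc _ _
    have hsplit : (∫ x in Ω, f x • (φ x • G x + f x • gradient φ x)) +
          ∫ x in Ω, (φ x * f x) • G x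
        = (∫ x in Ω, f x • (φ x • G x + f x • gradient φ x - gradient ψ x))
          + ∫ x in Ω, (φ x * f x - ψ x) • G x := by
      simp only [smul_sub, sub_smul]
      rw [integral_sub (integrable_smul_of_memLp_two hf m2) (integrable_smul_of_memLp_two hf n1),
        integral_sub (integrable_smul_of_memLp_two m1 hG) (integrable_smul_of_memLp_two n2 hG),
        h ψ hψ hψc hψs]
      abel
    refine absurd hε (not_lt.2 ?_)
    rw [hsplit]
    refine (enorm_add_le _ _).trans ?_
    rw [add_mul]
    refine add_le_add ?_ ?_
    · refine (enorm_integral_smul_le hf.1 (m2.sub n1).1).trans ?_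
      exact mul_le_mul_right e2 _
    · refine (enorm_integral_smul_le (m1.sub n2).1 hG.1).trans ?_
      rw [mul_comm]
      exact mul_le_mul_right e1 _
  have i1 : Integrable (fun x => φ x • f x • G x) (volume.restrict Ω) := by
    simpa only [smul_smul] using integrable_smul_of_memLp_two m1 hG
  have i2 : Integrable (fun x => f x ^ 2 • gradient φ x) (volume.restrict Ω) := by
    have := integrable_smul_of_memLp_two hf (memLp_smul_right (continuous_gradient hφ)
      (hasCompactSupport_gradient hφc) hf)
    simpa only [smul_smul, ← sq] using this
  have e1 : ∫ x in Ω, f x • (φ x • G x + f x • gradient φ x) =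
      (∫ x in Ω, φ x • f x • G x) + ∫ x in Ω, f x ^ 2 • gradient φ x := by
    rw [← integral_add i1 i2]
    congr 1 with x : 1
    module
  have e2 : ∫ x in Ω, (φ x * f x) • G x = ∫ x in Ω, φ x • f x • G x := by
    simp only [smul_smul]
  rw [e1, e2] at key
  rw [add_right_comm, add_comm] at key
  rw [eq_neg_of_add_eq_zero_left key]
  module

theorem SobolevMap.integral_normSq_smul_gradient (hΩ : IsOpen Ω) (u : SobolevMap Ω m)
    {φ : E → ℝ} (hφ : ContDiff ℝ ∞ φ) (hφc : HasCompactSupport φ) (hs : tsupport φ ⊆ Ω) :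
    ∫ x in Ω, ‖u.val x‖ ^ 2 • gradient φ x = - (2 : ℝ) • ∫ x in Ω, φ x • u.cross x := by
  have hi : ∀ i, Integrable (fun x => u.val x i ^ 2 • gradient φ x)
      (volume.restrict Ω) := fun i => by
    have := integrable_smul_of_memLp_two (u.memLp_coord i) (memLp_smul_right
      (continuous_gradient hφ) (hasCompactSupport_gradient hφc) (u.memLp_coord i))
    simpa only [smul_smul, ← sq] using this
  have hj : ∀ i, Integrable (fun x => φ x • u.val x i • u.grad i x)
      (volume.restrict Ω) := fun i => by
    have := integrable_smul_of_memLp_two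
      (memLp_smul_left hφ.continuous hφc (u.memLp_coord i)) (u.memLp_grad i)
    simpa only [smul_smul, smul_eq_mul] using this
  simp only [EuclideanSpace.real_norm_sq_eq, Finset.sum_smul, SobolevMap.cross, Finset.smul_sum]
  rw [integral_finsetSum _ fun i _ => hi i, integral_finsetSum _ fun i _ => hj i, Finset.smul_sum]
  exact Finset.sum_congr rfl fun i _ => (u.isWeakGradient i).integral_sq_smul_gradient hΩ
    (u.memLp_coord i) (u.memLp_grad i) hφ hφc hs

theorem integral_norm_sq_le_of_eLpNorm_le {α : Type*} [MeasurableSpace α] {μ : Measure α}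
    {V : Type*} [NormedAddCommGroup V] {f : α → V} (hf : MemLp f 2 μ) {ε : ℝ} (hε : 0 ≤ ε)
    (h : eLpNorm f 2 μ ≤ ENNReal.ofReal ε) : ∫ x, ‖f x‖ ^ 2 ∂μ ≤ ε ^ 2 := by
  have h0 : 0 ≤ ∫ x, ‖f x‖ ^ 2 ∂μ := integral_nonneg fun x => by positivity
  rw [hf.eLpNorm_eq_integral_rpow_norm (by norm_num) (by norm_num),
    ENNReal.ofReal_le_ofReal_iff hε] at h
  simp only [ENNReal.toReal_ofNat, Real.rpow_ofNat, ← one_div] at h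
  rw [← Real.sqrt_eq_rpow, Real.sqrt_le_left hε] at h
  exact h

theorem integrable_h1 {f : E → EuclideanSpace ℝ (Fin m)} {G : Fin m → E → E}
    (hf : MemLp f 2 (volume.restrict Ω)) (hG : ∀ i, MemLp (G i) 2 (volume.restrict Ω)) :
    IntegrableOn (fun x => ‖f x‖ ^ 2 + ∑ i, ‖G i x‖ ^ 2) Ω :=
  (integrable_norm_sq hf).add (integrable_finsetSum _ fun i _ => integrable_norm_sq (hG i))

theorem norm_sub_sq_le {V : Type*} [NormedAddCommGroup V] (a b : V) :
    ‖a - b‖ ^ 2 ≤ 2 * ‖a‖ ^ 2 + 2 * ‖b‖ ^ 2 := by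
  have h := norm_sub_le a b
  have h0 := norm_nonneg (a - b)
  nlinarith [sq_nonneg (‖a‖ - ‖b‖)]

/-- A weak triangle inequality: `|a - b|² ≤ 2 |a|² + 2 |b|²` suffices, since two errors below `ε /
2` give a square below `2 (ε / 2)² + 2 (ε / 2)² = ε²`. -/
theorem h1Norm_sub_lt {f₁ f₂ : E → EuclideanSpace ℝ (Fin m)} {G₁ G₂ : Fin m → E → E}
    (hf₁ : MemLp f₁ 2 (volume.restrict Ω)) (hG₁ : ∀ i, MemLp (G₁ i) 2 (volume.restrict Ω))
    (hf₂ : MemLp f₂ 2 (volume.restrict Ω)) (hG₂ : ∀ i, MemLp (G₂ i) 2 (volume.restrict Ω))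
    {ε : ℝ} (hε : 0 < ε) (h₁ : h1Norm Ω f₁ G₁ < ε / 2) (h₂ : h1Norm Ω f₂ G₂ < ε / 2) :
    h1Norm Ω (fun x => f₁ x - f₂ x) (fun i x => G₁ i x - G₂ i x) < ε := by
  rw [h1Norm, Real.sqrt_lt' (by positivity)] at h₁ h₂
  rw [h1Norm, Real.sqrt_lt' hε]
  have i₁ := (integrable_h1 hf₁ hG₁).const_mul 2
  have i₂ := (integrable_h1 hf₂ hG₂).const_mul 2
  have i₃ := integrable_h1 (hf₁.sub hf₂) fun i => (hG₁ i).sub (hG₂ i)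
  calc _ ≤ ∫ x in Ω, (2 * (‖f₁ x‖ ^ 2 + ∑ i, ‖G₁ i x‖ ^ 2) +
        2 * (‖f₂ x‖ ^ 2 + ∑ i, ‖G₂ i x‖ ^ 2)) := by
        refine integral_mono i₃ (i₁.add i₂) fun x => ?_
        have := Finset.sum_le_sum fun i (_ : i ∈ Finset.univ) => norm_sub_sq_le (G₁ i x) (G₂ i x)
        rw [Finset.sum_add_distrib, ← Finset.mul_sum, ← Finset.mul_sum] at this
        have h2 := norm_sub_sq_le (f₁ x) (f₂ x)
        linarith
    _ < ε ^ 2 := by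
        rw [integral_add i₁ i₂, integral_const_mul, integral_const_mul]
        nlinarith

/-- The localization `φ u` of `u ∈ H¹(Ω; ℝᵐ)` is a limit of test functions. -/
theorem SobolevMap.exists_test_approx (hΩ : IsOpen Ω) (u : SobolevMap Ω m) {φ : E → ℝ}
    (hφ : ContDiff ℝ ∞ φ) (hc : HasCompactSupport φ) (hs : tsupport φ ⊆ Ω) {ε : ℝ} (hε : 0 < ε) :
    ∃ Φ : E → EuclideanSpace ℝ (Fin m), ContDiff ℝ ∞ Φ ∧ HasCompactSupport Φ ∧ tsupport Φ ⊆ Ω ∧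
      h1Norm Ω (fun x => φ x • u.val x - Φ x) (fun i x => φ x • u.grad i x
        + u.val x i • gradient φ x - gradient (fun y => Φ y i) x) < ε := by
  obtain ⟨η, hη0, hη⟩ : ∃ η : ℝ, 0 < η ∧ m * (2 * η ^ 2) < ε ^ 2 := by
    refine ⟨ε / (2 * (m + 1)), by positivity, ?_⟩
    have hm : (0 : ℝ) ≤ m := m.cast_nonneg
    calc m * (2 * (ε / (2 * (m + 1))) ^ 2) = ε ^ 2 * (m / (2 * (m + 1) ^ 2)) := by field_simp
      _ < ε ^ 2 * 1 := by
        refine mul_lt_mul_of_pos_left ?_ (by positivity)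
        rw [div_lt_one (by positivity)]
        nlinarith
      _ = ε ^ 2 := mul_one _
  have H := fun i => (u.isWeakGradient i).exists_test_approx hΩ (u.memLp_coord i) (u.memLp_grad i)
    hφ hc hs (ε := ENNReal.ofReal η) (by simpa using hη0)
  choose ψ hψ hψc hψs e1 e2 using H
  set Φ : E → EuclideanSpace ℝ (Fin m) := fun x => WithLp.toLp 2 fun i => ψ i x with hΦ
  have hcoord : ∀ i, (fun y => Φ y i) = ψ i := fun i => rfl
  have hsub : tsupport Φ ⊆ ⋃ i, tsupport (ψ i) := by
    refine closure_minimal ?_ (isClosed_iUnion_of_finite fun i => isClosed_tsupport _)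
    intro x hx
    by_contra hn
    rw [Set.mem_iUnion, not_exists] at hn
    refine hx ?_
    ext i
    exact image_eq_zero_of_notMem_tsupport (f := ψ i) (hn i)
  refine ⟨Φ, contDiff_euclidean.2 hψ, (isCompact_iUnion hψc).of_isClosed_subset
    (isClosed_tsupport _) hsub, hsub.trans (Set.iUnion_subset hψs), ?_⟩
  have m1 : ∀ i, MemLp (fun x => φ x * u.val x i - ψ i x) 2 (volume.restrict Ω) := fun i =>
    (memLp_smul_left hφ.continuous hc (u.memLp_coord i)).sub
      (memLp_of_hasCompactSupport (hψ i).continuous (hψc i) _ _)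
  have m2 : ∀ i, MemLp (fun x => φ x • u.grad i x + u.val x i • gradient φ x - gradient (ψ i) x) 2
      (volume.restrict Ω) := fun i =>
    (memLp_weakGradient_mul (u.memLp_coord i) (u.memLp_grad i) hφ hc).sub
      (memLp_of_hasCompactSupport (continuous_gradient (hψ i)) (hasCompactSupport_gradient (hψc i))
        _ _)
  rw [h1Norm, Real.sqrt_lt' hε]
  calc _ = ∫ x in Ω, ∑ i, (‖φ x * u.val x i - ψ i x‖ ^ 2 +
        ‖φ x • u.grad i x + u.val x i • gradient φ x - gradient (ψ i) x‖ ^ 2) := by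
        congr 1 with x : 1
        rw [EuclideanSpace.norm_sq_eq, Finset.sum_add_distrib]
        rfl
    _ = ∑ i, ∫ x in Ω, (‖φ x * u.val x i - ψ i x‖ ^ 2 +
        ‖φ x • u.grad i x + u.val x i • gradient φ x - gradient (ψ i) x‖ ^ 2) :=
        integral_finsetSum _ fun i _ => (integrable_norm_sq (m1 i)).add (integrable_norm_sq (m2 i))
    _ ≤ ∑ _i : Fin m, 2 * η ^ 2 := by
        refine Finset.sum_le_sum fun i _ => ?_
        rw [integral_add (integrable_norm_sq (m1 i)) (integrable_norm_sq (m2 i))]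
        have h1 := integral_norm_sq_le_of_eLpNorm_le (m1 i) hη0.le (e1 i)
        have h2 := integral_norm_sq_le_of_eLpNorm_le (m2 i) hη0.le (e2 i)
        linarith
    _ = m * (2 * η ^ 2) := by simp
    _ < ε ^ 2 := hη

/-- Subtracting a test function close to `φ u` from one close to `u - g` gives one close to `(1 - φ)
u - g`. -/
theorem EqOnBoundary.mulCut (hΩ : IsOpen Ω) {g u : SobolevMap Ω m} (h : EqOnBoundary u g)
    {φ : E → ℝ} (hφ : ContDiff ℝ ∞ φ) (hc : HasCompactSupport φ) (hs : tsupport φ ⊆ Ω) :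
    EqOnBoundary (u.mulCut hφ hc) g := by
  intro ε hε
  obtain ⟨Φ₁, s₁, c₁, t₁, h₁⟩ := h (ε / 2) (by positivity)
  obtain ⟨Φ₂, s₂, c₂, t₂, h₂⟩ := u.exists_test_approx hΩ hφ hc hs (ε := ε / 2) (by positivity)
  have g₁ : ∀ i, ContDiff ℝ ∞ fun y => Φ₁ y i := contDiff_euclidean.1 s₁
  have g₂ : ∀ i, ContDiff ℝ ∞ fun y => Φ₂ y i := contDiff_euclidean.1 s₂
  have k₁ : ∀ i, HasCompactSupport fun y => Φ₁ y i := fun i =>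
    c₁.comp_left (g := fun v : EuclideanSpace ℝ (Fin m) => v i) rfl
  have k₂ : ∀ i, HasCompactSupport fun y => Φ₂ y i := fun i =>
    c₂.comp_left (g := fun v : EuclideanSpace ℝ (Fin m) => v i) rfl
  refine ⟨fun x => Φ₁ x - Φ₂ x, s₁.sub s₂, c₁.sub c₂,
    (tsupport_sub _ _).trans (Set.union_subset t₁ t₂), ?_⟩
  have key := h1Norm_sub_lt
    ((u.memLp_val.sub g.memLp_val).sub (memLp_of_hasCompactSupport s₁.continuous c₁ _ _))
    (fun i => ((u.memLp_grad i).sub (g.memLp_grad i)).sub (memLp_of_hasCompactSupport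
      (continuous_gradient (g₁ i)) (hasCompactSupport_gradient (k₁ i)) _ _))
    ((memLp_smul_left hφ.continuous hc u.memLp_val).sub
      (memLp_of_hasCompactSupport s₂.continuous c₂ _ _))
    (fun i => (memLp_weakGradient_mul (u.memLp_coord i) (u.memLp_grad i) hφ hc).sub
      (memLp_of_hasCompactSupport
      (continuous_gradient (g₂ i)) (hasCompactSupport_gradient (k₂ i)) _ _)) hε h₁ h₂
  convert key using 1
  congr 1
  · funext x
    simp only [SobolevMap.mulCut, Pi.sub_apply]
    abel
  · funext i x
    have : gradient (fun y => (Φ₁ y - Φ₂ y) i) x =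
        gradient (fun y => Φ₁ y i) x - gradient (fun y => Φ₂ y i) x :=
      gradient_sub ((g₁ i).differentiable (by simp) x) ((g₂ i).differentiable (by simp) x)
    rw [this]
    simp only [SobolevMap.mulCut, Pi.sub_apply]
    abel

theorem Admissible.mulCut (hΩ : IsOpen Ω) {g u : SobolevMap Ω m} (h : Admissible g u)
    {φ : E → ℝ} (hφ : ContDiff ℝ ∞ φ) (hc : HasCompactSupport φ) (hs : tsupport φ ⊆ Ω)
    (h1 : ∀ x, φ x ≤ 1) : Admissible g (u.mulCut hφ hc) := by
  refine ⟨h.1.mulCut hΩ hφ hc hs, fun i => ?_⟩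
  filter_upwards [h.2 i] with x hx
  have : (u.mulCut hφ hc).val x i = (1 - φ x) * u.val x i := by
    simp only [SobolevMap.mulCut, PiLp.sub_apply, PiLp.smul_apply, smul_eq_mul]
    ring
  rw [this]
  exact mul_nonneg (sub_nonneg.2 (h1 x)) hx

/-! ### Radial kernels and the mean value inequality for weakly subharmonic functions. -/

/-- A smooth nonnegative profile on `ℝ` that vanishes on `[1, ∞)` and is positive at `0`. -/
def profile (s : ℝ) : ℝ := deriv expNegInvGlue (1 - s)

theorem contDiff_deriv_expNegInvGlue : ContDiff ℝ ∞ (deriv expNegInvGlue) :=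
  (contDiff_infty_iff_deriv.1 (expNegInvGlue.contDiff (n := ⊤))).2

theorem contDiff_profile : ContDiff ℝ ∞ profile :=
  contDiff_deriv_expNegInvGlue.comp (contDiff_const.sub contDiff_id)

theorem profile_nonneg (s : ℝ) : 0 ≤ profile s :=
  expNegInvGlue.monotone.deriv_nonneg

theorem profile_of_one_lt {s : ℝ} (hs : 1 < s) : profile s = 0 := by
  have : expNegInvGlue =ᶠ[𝓝 (1 - s)] fun _ => 0 := by
    filter_upwards [Iio_mem_nhds (show 1 - s < 0 by linarith)] with t ht
    exact expNegInvGlue.zero_of_nonpos (Set.mem_Iio.1 ht).le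
  rw [profile, this.deriv_eq, deriv_const]

theorem profile_zero_pos : 0 < profile 0 := by
  have h : expNegInvGlue =ᶠ[𝓝 1] fun t => Real.exp (-t⁻¹) := by
    filter_upwards [Ioi_mem_nhds (show (0 : ℝ) < 1 by norm_num)] with t ht
    simp [expNegInvGlue, not_le.2 (Set.mem_Ioi.1 ht)]
  have hd : HasDerivAt (fun t : ℝ => Real.exp (-t⁻¹)) (Real.exp (-(1 : ℝ)⁻¹) * 1) 1 := by
    have := ((hasDerivAt_inv (one_ne_zero (α := ℝ))).neg).exp
    simpa using this
  rw [profile, sub_zero, h.deriv_eq, hd.deriv]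
  positivity

theorem deriv_profile_of_one_lt {s : ℝ} (hs : 1 < s) : deriv profile s = 0 := by
  have : profile =ᶠ[𝓝 s] fun _ => 0 := by
    filter_upwards [Ioi_mem_nhds hs] with t ht
    exact profile_of_one_lt ht
  rw [this.deriv_eq, deriv_const]

theorem continuous_deriv_profile : Continuous (deriv profile) :=
  contDiff_profile.continuous_deriv (by simp)

/-- The second bound concerns the factor `s · profile' s` that appears when the kernel is
differentiated in its radius. -/
theorem exists_profile_bound : ∃ C, 0 < C ∧ (∀ s, 0 ≤ s → profile s ≤ C) ∧
    ∀ s, 0 ≤ s → |deriv profile s * s| ≤ C := by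
  have h1 : ContinuousOn profile (Set.Icc 0 1) := contDiff_profile.continuous.continuousOn
  have h2 : ContinuousOn (fun s => deriv profile s * s) (Set.Icc 0 1) :=
    (continuous_deriv_profile.mul continuous_id).continuousOn
  obtain ⟨C₁, hC₁⟩ := isCompact_Icc.exists_bound_of_continuousOn h1
  obtain ⟨C₂, hC₂⟩ := isCompact_Icc.exists_bound_of_continuousOn h2
  refine ⟨max 1 (max C₁ C₂), by positivity, fun s hs => ?_, fun s hs => ?_⟩
  · rcases le_or_gt s 1 with h | h
    · exact (le_abs_self _).trans ((hC₁ s ⟨hs, h⟩).trans ((le_max_left _ _).trans (le_max_right _ _)))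
    · rw [profile_of_one_lt h]; positivity
  · rcases le_or_gt s 1 with h | h
    · exact (hC₂ s ⟨hs, h⟩).trans ((le_max_right _ _).trans (le_max_right _ _))
    · rw [deriv_profile_of_one_lt h]; simp

/-- The radial kernel with the given profile, centre and radius. -/
def kernel (y : E) (R : ℝ) (x : E) : ℝ := profile (‖x - y‖ ^ 2 / R ^ 2)

theorem contDiff_normSq_sub_div (y : E) (R : ℝ) :
    ContDiff ℝ ∞ fun x : E => ‖x - y‖ ^ 2 / R ^ 2 :=
  ((contDiff_id.sub contDiff_const).norm_sq ℝ).div_const _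

theorem contDiff_kernel (y : E) (R : ℝ) : ContDiff ℝ ∞ (kernel y R) :=
  contDiff_profile.comp (contDiff_normSq_sub_div y R)

theorem one_lt_of_notMem_closedBall {y : E} {R : ℝ} (hR : 0 < R) {x : E}
    (hx : x ∉ Metric.closedBall y R) : 1 < ‖x - y‖ ^ 2 / R ^ 2 := by
  rw [Metric.mem_closedBall, not_le, dist_eq_norm] at hx
  rw [one_lt_div (by positivity)]
  gcongr

theorem tsupport_subset_closedBall {F : Type*} [Zero F] {f : E → F} {y : E} {R : ℝ}
    (h : ∀ x ∉ Metric.closedBall y R, f x = 0) : tsupport f ⊆ Metric.closedBall y R :=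
  closure_minimal (fun x hx => by by_contra hn; exact hx (h x hn)) Metric.isClosed_closedBall

theorem kernel_of_notMem {y : E} {R : ℝ} (hR : 0 < R) {x : E}
    (hx : x ∉ Metric.closedBall y R) : kernel y R x = 0 :=
  profile_of_one_lt (one_lt_of_notMem_closedBall hR hx)

theorem hasCompactSupport_of_closedBall {F : Type*} [Zero F] {f : E → F} {y : E} {R : ℝ}
    (h : ∀ x ∉ Metric.closedBall y R, f x = 0) : HasCompactSupport f :=
  HasCompactSupport.intro (isCompact_closedBall y R) h

theorem gradient_normSq_sub_div (y : E) (R : ℝ) (x : E) :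
    gradient (fun x : E => ‖x - y‖ ^ 2 / R ^ 2) x = (2 / R ^ 2) • (x - y) := by
  have : (fun x : E => ‖x - y‖ ^ 2 / R ^ 2) = fun x => (R ^ 2)⁻¹ * ‖x - y‖ ^ 2 := by
    funext x; ring
  rw [this, gradient_const_mul (f := fun x => ‖x - y‖ ^ 2)
    (((differentiable_id.sub_const y).norm_sq ℝ) x), gradient_norm_sub_sq, smul_smul]
  congr 1
  ring

theorem gradient_kernel (y : E) (R : ℝ) (x : E) :
    gradient (kernel y R) x =
      (deriv profile (‖x - y‖ ^ 2 / R ^ 2) * (2 / R ^ 2)) • (x - y) := by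
  have := gradient_comp (h := profile) (f := fun x : E => ‖x - y‖ ^ 2 / R ^ 2) (x := x)
    ((contDiff_profile.differentiable (by simp)) _).hasDerivAt
    ((contDiff_normSq_sub_div y R).differentiable (by simp) x)
  rw [gradient_normSq_sub_div, smul_smul] at this
  exact this

/-- The radial test function whose gradient is a multiple of `(x - y) kernel y R x`. -/
def potential (y : E) (R : ℝ) (x : E) : ℝ := expNegInvGlue (1 - ‖x - y‖ ^ 2 / R ^ 2)

theorem contDiff_potential (y : E) (R : ℝ) : ContDiff ℝ ∞ (potential y R) :=
  (expNegInvGlue.contDiff (n := ⊤)).comp (contDiff_const.sub (contDiff_normSq_sub_div y R))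

theorem potential_of_notMem {y : E} {R : ℝ} (hR : 0 < R) {x : E}
    (hx : x ∉ Metric.closedBall y R) : potential y R x = 0 :=
  expNegInvGlue.zero_of_nonpos (by linarith [one_lt_of_notMem_closedBall hR hx])

theorem gradient_potential (y : E) (R : ℝ) (x : E) :
    gradient (potential y R) x = -((2 / R ^ 2) • kernel y R x • (x - y)) := by
  have hd := (contDiff_normSq_sub_div y R).differentiable (by simp) x
  have := gradient_comp (h := expNegInvGlue) (f := fun x : E => 1 - ‖x - y‖ ^ 2 / R ^ 2) (x := x)
    (((expNegInvGlue.contDiff (n := ⊤)).differentiable (by simp)) _).hasDerivAt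
    ((differentiableAt_const _).sub hd)
  rw [gradient_sub (f := fun _ => 1) (differentiableAt_const _) hd, gradient_fun_const, zero_sub,
    gradient_normSq_sub_div] at this
  refine this.trans ?_
  rw [kernel, profile]
  module

theorem integrable_smul_of_hasCompactSupport {V : Type*} [NormedAddCommGroup V] [NormedSpace ℝ V]
    {f : E → ℝ} {φ : E → V} {μ : Measure E} (hf : Integrable f μ) (hφ : Continuous φ)
    (hc : HasCompactSupport φ) : Integrable (fun x => f x • φ x) μ :=
  memLp_one_iff_integrable.1 (memLp_smul_right hφ hc (memLp_one_iff_integrable.2 hf))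

theorem integrable_hasCompactSupport_smul {V : Type*} [NormedAddCommGroup V] [NormedSpace ℝ V]
    {f : E → V} {φ : E → ℝ} {μ : Measure E} (hf : Integrable f μ) (hφ : Continuous φ)
    (hc : HasCompactSupport φ) : Integrable (fun x => φ x • f x) μ :=
  memLp_one_iff_integrable.1 (memLp_smul_left hφ hc (memLp_one_iff_integrable.2 hf))

theorem contDiff_coord_sub (j : Fin n) (y : E) : ContDiff ℝ ∞ fun x : E => x j - y j :=
  (EuclideanSpace.proj (𝕜 := ℝ) j).contDiff.sub contDiff_const

theorem gradient_coord_sub (j : Fin n) (y x : E) :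
    gradient (fun x : E => x j - y j) x = EuclideanSpace.single j 1 := by
  have h : HasFDerivAt (fun x : E => x j - y j) (EuclideanSpace.proj (𝕜 := ℝ) j) x :=
    (EuclideanSpace.proj (𝕜 := ℝ) j).hasFDerivAt.sub_const _
  rw [gradient, h.fderiv, LinearIsometryEquiv.symm_apply_eq]
  ext v
  simp [EuclideanSpace.inner_single_left]

/-- Testing subharmonicity with the radial potential. -/
theorem integral_kernel_le {f : E → ℝ} {H : E → E} (hf : IntegrableOn f Ω)
    (hH : IntegrableOn H Ω)
    (hw : IsWeakGradient Ω f H)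
    (hsub : ∀ φ : E → ℝ, ContDiff ℝ ∞ φ → HasCompactSupport φ → tsupport φ ⊆ Ω →
      (∀ x, 0 ≤ φ x) → ∫ x in Ω, inner ℝ (H x) (gradient φ x) ≤ 0)
    {y : E} {R : ℝ} (hR : 0 < R) (hy : Metric.closedBall y R ⊆ Ω) :
    ∫ x in Ω, f x * (n * kernel y R x + 2 *
      (deriv profile (‖x - y‖ ^ 2 / R ^ 2) * (‖x - y‖ ^ 2 / R ^ 2))) ≤ 0 := by
  -- These are the components of the field `(x - y) kernel y R x`, whose divergence is the weight in
  -- the claim; each one serves as a test function in `hw`.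
  set θ : Fin n → E → ℝ := fun j x => (x j - y j) * kernel y R x with hθ
  have hθs : ∀ j, ContDiff ℝ ∞ (θ j) := fun j => (contDiff_coord_sub j y).mul (contDiff_kernel y R)
  have hθ0 : ∀ j, ∀ x ∉ Metric.closedBall y R, θ j x = 0 := fun j x hx => by
    simp [hθ, kernel_of_notMem hR hx]
  have hθc : ∀ j, HasCompactSupport (θ j) := fun j => hasCompactSupport_of_closedBall (hθ0 j)
  have hθt : ∀ j, tsupport (θ j) ⊆ Ω := fun j => (tsupport_subset_closedBall (hθ0 j)).trans hy
  have hθg : ∀ j x, gradient (θ j) x j = (x j - y j) ^ 2 *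
      (deriv profile (‖x - y‖ ^ 2 / R ^ 2) * (2 / R ^ 2)) + kernel y R x := by
    intro j x
    rw [hθ, gradient_smooth_mul (contDiff_coord_sub j y) (contDiff_kernel y R),
      gradient_coord_sub, gradient_kernel]
    simp
    ring
  have i1 : ∀ j, Integrable (fun x => f x • gradient (θ j) x) (volume.restrict Ω) := fun j =>
    integrable_smul_of_hasCompactSupport hf (continuous_gradient (hθs j))
      (hasCompactSupport_gradient (hθc j))
  have i2 : ∀ j, Integrable (fun x => θ j x • H x) (volume.restrict Ω) := fun j =>
    integrable_hasCompactSupport_smul hH (hθs j).continuous (hθc j)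
  have hj : ∀ j, ∫ x in Ω, f x * gradient (θ j) x j = - ∫ x in Ω, θ j x * H x j := by
    intro j
    have h1 := (EuclideanSpace.proj (𝕜 := ℝ) j).integral_comp_comm (i1 j)
    have h2 := (EuclideanSpace.proj (𝕜 := ℝ) j).integral_comp_comm (i2 j)
    rw [hw (θ j) (hθs j) (hθc j) (hθt j), map_neg, ← h2] at h1
    simpa using h1
  have k1 : ∀ j, Integrable (fun x => f x * gradient (θ j) x j) (volume.restrict Ω) := fun j => by
    simpa using (EuclideanSpace.proj (𝕜 := ℝ) j).integrable_comp (i1 j)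
  have k2 : ∀ j, Integrable (fun x => θ j x * H x j) (volume.restrict Ω) := fun j => by
    simpa using (EuclideanSpace.proj (𝕜 := ℝ) j).integrable_comp (i2 j)
  have hpot := hsub (potential y R) (contDiff_potential y R)
    (hasCompactSupport_of_closedBall fun x => potential_of_notMem hR)
    ((tsupport_subset_closedBall fun x => potential_of_notMem hR).trans hy)
    (fun x => expNegInvGlue.nonneg _)
  calc _ = ∫ x in Ω, ∑ j, f x * gradient (θ j) x j := by
        congr 1 with x : 1
        simp only [hθg, mul_add, Finset.sum_add_distrib, ← Finset.mul_sum, ← Finset.sum_mul,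
          Finset.sum_const, Finset.card_univ, Fintype.card_fin, nsmul_eq_mul]
        have : ∑ j, (x j - y j) ^ 2 = ‖x - y‖ ^ 2 := by
          rw [EuclideanSpace.real_norm_sq_eq]; rfl
        rw [this]
        ring
    _ = - ∫ x in Ω, ∑ j, θ j x * H x j := by
        rw [integral_finsetSum _ fun j _ => k1 j, integral_finsetSum _ fun j _ => k2 j,
          ← Finset.sum_neg_distrib]
        exact Finset.sum_congr rfl fun j _ => hj j
    -- The field equals `-(R² / 2)` times the gradient of `potential`, a nonnegative test function,
    -- so subharmonicity fixes the sign.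
    _ = R ^ 2 / 2 * ∫ x in Ω, inner ℝ (H x) (gradient (potential y R) x) := by
        rw [← integral_neg, ← integral_const_mul]
        congr 1 with x : 1
        rw [gradient_potential, inner_neg_right, real_inner_smul_right, real_inner_smul_right,
          PiLp.inner_apply, mul_neg, neg_inj, Finset.mul_sum, Finset.mul_sum, Finset.mul_sum]
        refine Finset.sum_congr rfl fun j _ => ?_
        simp [hθ]
        field_simp
    _ ≤ 0 := mul_nonpos_of_nonneg_of_nonpos (by positivity) hpot

theorem hasDerivAt_kernel (y x : E) {R : ℝ} (hR : R ≠ 0) :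
    HasDerivAt (fun r => kernel y r x) (-(2 / R) *
      (deriv profile (‖x - y‖ ^ 2 / R ^ 2) * (‖x - y‖ ^ 2 / R ^ 2))) R := by
  have h1 : HasDerivAt (fun r : ℝ => ‖x - y‖ ^ 2 / r ^ 2) (-(2 / R) * (‖x - y‖ ^ 2 / R ^ 2)) R := by
    have := ((hasDerivAt_pow 2 R).fun_inv (by positivity)).const_mul (‖x - y‖ ^ 2)
    simp only [div_eq_mul_inv]
    refine this.congr_deriv ?_
    simp
    field_simp
  have h2 := ((contDiff_profile.differentiable (by simp)) (‖x - y‖ ^ 2 / R ^ 2)).hasDerivAt.comp R h1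
  refine HasDerivAt.congr_deriv h2 ?_
  ring

theorem hasDerivAt_integral_kernel {f : E → ℝ} (hf : IntegrableOn f Ω) (y : E) {R : ℝ}
    (hR : 0 < R) :
    HasDerivAt (fun r => ∫ x in Ω, f x * kernel y r x)
      (∫ x in Ω, f x * (-(2 / R) *
        (deriv profile (‖x - y‖ ^ 2 / R ^ 2) * (‖x - y‖ ^ 2 / R ^ 2)))) R := by
  obtain ⟨C, hC0, -, hC⟩ := exists_profile_bound
  have hcont : ∀ r : ℝ, Continuous fun x : E => ‖x - y‖ ^ 2 / r ^ 2 := fun r =>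
    (contDiff_normSq_sub_div y r).continuous
  refine (hasDerivAt_integral_of_dominated_loc_of_deriv_le (μ := volume.restrict Ω)
    (F := fun r x => f x * kernel y r x)
    (F' := fun r x => f x * (-(2 / r) *
        (deriv profile (‖x - y‖ ^ 2 / r ^ 2) * (‖x - y‖ ^ 2 / r ^ 2))))
    -- For `r > R / 2` the factor `2 / r` is at most `4 / R`, which gives a bound uniform in `r`.
    (s := Set.Ioi (R / 2)) (bound := fun x => ‖f x‖ * (4 / R * C)) (Ioi_mem_nhds (by linarith))
    (Eventually.of_forall fun r => hf.1.mul
      (contDiff_kernel y r).continuous.aestronglyMeasurable) ?_ ?_ ?_ ?_ ?_).2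
  · exact integrable_smul_of_hasCompactSupport hf (contDiff_kernel y R).continuous
      (hasCompactSupport_of_closedBall fun x => kernel_of_notMem hR)
  · exact hf.1.mul (continuous_const.mul ((continuous_deriv_profile.comp (hcont R)).mul
      (hcont R))).aestronglyMeasurable
  · refine Eventually.of_forall fun x r hr => ?_
    have hr' : R / 2 < r := hr
    have hr0 : 0 < r := by linarith
    rw [norm_mul, norm_mul, norm_neg, Real.norm_of_nonneg (show 0 ≤ 2 / r by positivity)]
    gcongr ?_ * (?_ * ?_)
    · rw [div_le_div_iff₀ hr0 hR]; linarith
    · exact hC _ (by positivity)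
  · exact hf.norm.mul_const _
  · refine Eventually.of_forall fun x r hr => ?_
    have hr' : R / 2 < r := hr
    exact (hasDerivAt_kernel y x (by linarith)).const_mul (f x)

/-- The derivative in `R` is `-R^{-(n+1)}` times the integral that `integral_kernel_le` shows to be
nonpositive. -/
theorem monotoneOn_kernel_mean {f : E → ℝ} {H : E → E} (hf : IntegrableOn f Ω)
    (hH : IntegrableOn H Ω)
    (hw : IsWeakGradient Ω f H)
    (hsub : ∀ φ : E → ℝ, ContDiff ℝ ∞ φ → HasCompactSupport φ → tsupport φ ⊆ Ω →
      (∀ x, 0 ≤ φ x) → ∫ x in Ω, inner ℝ (H x) (gradient φ x) ≤ 0)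
    {y : E} {t : ℝ} (hy : Metric.closedBall y t ⊆ Ω) :
    MonotoneOn (fun R => (R ^ n)⁻¹ * ∫ x in Ω, f x * kernel y R x) (Set.Ioc 0 t) := by
  have hd : ∀ R, 0 < R → HasDerivAt (fun R => (R ^ n)⁻¹ * ∫ x in Ω, f x * kernel y R x)
      (-(R ^ (n + 1))⁻¹ * ∫ x in Ω, f x * (n * kernel y R x + 2 *
      (deriv profile (‖x - y‖ ^ 2 / R ^ 2) * (‖x - y‖ ^ 2 / R ^ 2)))) R := by
    intro R hR
    have h1 := ((hasDerivAt_pow n R).fun_inv (by positivity)).fun_mul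
      (hasDerivAt_integral_kernel hf y hR)
    refine h1.congr_deriv ?_
    have i1 : Integrable (fun x => f x * kernel y R x) (volume.restrict Ω) :=
      integrable_smul_of_hasCompactSupport hf (contDiff_kernel y R).continuous
        (hasCompactSupport_of_closedBall fun x => kernel_of_notMem hR)
    have i2 : Integrable (fun x => f x * (deriv profile (‖x - y‖ ^ 2 / R ^ 2) *
        (‖x - y‖ ^ 2 / R ^ 2))) (volume.restrict Ω) := by
      have hc : Continuous fun x : E => ‖x - y‖ ^ 2 / R ^ 2 :=
        (contDiff_normSq_sub_div y R).continuous
      exact integrable_smul_of_hasCompactSupport hf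
        ((continuous_deriv_profile.comp hc).mul hc)
        (hasCompactSupport_of_closedBall (y := y) (R := R) fun x hx => by
          simp [deriv_profile_of_one_lt (one_lt_of_notMem_closedBall hR hx)])
    have e1 : ∫ x in Ω, f x * (n * kernel y R x + 2 *
        (deriv profile (‖x - y‖ ^ 2 / R ^ 2) * (‖x - y‖ ^ 2 / R ^ 2))) =
        n * (∫ x in Ω, f x * kernel y R x) + 2 * ∫ x in Ω, f x *
          (deriv profile (‖x - y‖ ^ 2 / R ^ 2) * (‖x - y‖ ^ 2 / R ^ 2)) := by
      rw [← integral_const_mul, ← integral_const_mul,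
        ← integral_add (i1.const_mul _) (i2.const_mul _)]
      congr 1 with x : 1
      ring
    have e2 : ∫ x in Ω, f x * (-(2 / R) *
        (deriv profile (‖x - y‖ ^ 2 / R ^ 2) * (‖x - y‖ ^ 2 / R ^ 2))) =
        -(2 / R) * ∫ x in Ω, f x *
          (deriv profile (‖x - y‖ ^ 2 / R ^ 2) * (‖x - y‖ ^ 2 / R ^ 2)) := by
      rw [← integral_const_mul]
      congr 1 with x : 1
      ring
    rw [e1, e2]
    -- The derivative of `R ^ n` carries the truncated exponent `n - 1`, so `n = 0` is separate.
    rcases n.eq_zero_or_pos with h0 | hn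
    · subst h0
      simp
      ring
    · obtain ⟨k, rfl⟩ := Nat.exists_eq_succ_of_ne_zero hn.ne'
      simp only [Nat.succ_eq_add_one, Nat.add_sub_cancel]
      field_simp
      ring
  refine monotoneOn_of_deriv_nonneg (convex_Ioc 0 t)
    (fun R hR => (hd R hR.1).continuousAt.continuousWithinAt)
    (fun R hR => ?_) (fun R hR => ?_)
  · rw [interior_Ioc] at hR
    exact (hd R hR.1).differentiableAt.differentiableWithinAt
  · rw [interior_Ioc] at hR
    rw [(hd R hR.1).deriv]
    have h1 := integral_kernel_le hf hH hw hsub hR.1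
      ((Metric.closedBall_subset_closedBall hR.2.le).trans hy)
    have : 0 < R ^ (n + 1) := pow_pos hR.1 _
    rw [neg_mul, ← mul_neg]
    exact mul_nonneg (by positivity) (by linarith)

theorem integral_kernel (y : E) {R : ℝ} (hR : 0 < R) :
    ∫ x, kernel y R x = R ^ n * ∫ x : E, kernel 0 1 x := by
  have h1 : ∀ x, kernel y R x = kernel (0 : E) 1 (R⁻¹ • (x - y)) := by
    intro x
    simp only [kernel, sub_zero, norm_smul, mul_pow, norm_inv, Real.norm_of_nonneg hR.le]
    congr 1
    ring
  simp only [h1]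
  rw [integral_sub_right_eq_self (fun x => kernel (0 : E) 1 (R⁻¹ • x)) y,
    Measure.integral_comp_inv_smul_of_nonneg _ _ hR.le]
  simp

theorem integral_kernel_pos : 0 < ∫ x : E, kernel 0 1 x := by
  refine (contDiff_kernel 0 1).continuous.integral_pos_of_hasCompactSupport_nonneg_nonzero
    (hasCompactSupport_of_closedBall fun _ => kernel_of_notMem one_pos)
    (fun _ => profile_nonneg _) (x := 0) ?_
  simpa [kernel] using profile_zero_pos.ne'

theorem integrable_kernel (y : E) {R : ℝ} (hR : 0 < R) : Integrable (kernel y R) :=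
  (contDiff_kernel y R).continuous.integrable_of_hasCompactSupport
    (hasCompactSupport_of_closedBall fun _ => kernel_of_notMem hR)

theorem volume_real_closedBall (y : E) {R : ℝ} (hR : 0 ≤ R) :
    volume.real (Metric.closedBall y R) = R ^ n * volume.real (Metric.ball (0 : E) 1) := by
  rw [Measure.addHaar_real_closedBall _ _ hR]
  simp

/-- At a Lebesgue point the mean oscillation over `B_R(y)` tends to zero; it dominates the error
because the kernel is bounded and supported in that ball. -/
theorem ae_tendsto_kernel_mean {F : E → ℝ} (hF : Integrable F) :
    ∀ᵐ y, Tendsto (fun R => (R ^ n)⁻¹ * ∫ x, F x * kernel y R x) (𝓝[>] 0)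
      (𝓝 (F y * ∫ x : E, kernel 0 1 x)) := by
  obtain ⟨C, hC0, hC, -⟩ := exists_profile_bound
  filter_upwards [IsUnifLocDoublingMeasure.ae_tendsto_average_norm_sub
    (μ := (volume : Measure E)) hF.locallyIntegrable 1] with y hy
  have ht := hy (fun _ => y) (fun R : ℝ => R) (l := 𝓝[>] 0) tendsto_id (by
    filter_upwards [self_mem_nhdsWithin] with R hR
    simpa using (Set.mem_Ioi.1 hR).le)
  rw [tendsto_iff_norm_sub_tendsto_zero]
  have ht2 := ht.const_mul (C * volume.real (Metric.ball (0 : E) 1))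
  rw [mul_zero] at ht2
  refine squeeze_zero' (Eventually.of_forall fun R => norm_nonneg _) ?_ ht2
  filter_upwards [self_mem_nhdsWithin] with R hR
  have hR : 0 < R := hR
  have hRn : 0 < R ^ n := pow_pos hR n
  have i1 : Integrable (fun x => F x * kernel y R x) :=
    integrable_smul_of_hasCompactSupport hF (contDiff_kernel y R).continuous
      (hasCompactSupport_of_closedBall fun x => kernel_of_notMem hR)
  have i2 : Integrable (fun x => F y * kernel y R x) := (integrable_kernel y hR).const_mul _
  have e : (R ^ n)⁻¹ * (∫ x, F x * kernel y R x) - F y * ∫ x : E, kernel 0 1 x =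
      (R ^ n)⁻¹ * ∫ x in Metric.closedBall y R, (F x - F y) * kernel y R x := by
    rw [setIntegral_eq_integral_of_forall_compl_eq_zero
      (fun x hx => by simp [kernel_of_notMem hR hx])]
    simp only [sub_mul]
    rw [integral_sub i1 i2, integral_const_mul, integral_kernel y hR]
    field_simp
  have hint : IntegrableOn (fun x => ‖F x - F y‖) (Metric.closedBall y R) :=
    (hF.integrableOn.sub (integrableOn_const (by
      exact (isCompact_closedBall y R).measure_lt_top.ne))).norm
  rw [e, norm_mul, Real.norm_of_nonneg (inv_nonneg.2 hRn.le)]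
  calc _ ≤ (R ^ n)⁻¹ * ∫ x in Metric.closedBall y R, C * ‖F x - F y‖ := by
        gcongr
        refine norm_integral_le_of_norm_le (hint.const_mul C) (Eventually.of_forall fun x => ?_)
        rw [norm_mul, mul_comm, Real.norm_of_nonneg (r := kernel y R x) (profile_nonneg _)]
        gcongr
        exact hC _ (by positivity)
    _ = _ := by
        have hv : 0 < volume.real (Metric.ball (0 : E) 1) :=
          ENNReal.toReal_pos (Metric.measure_ball_pos _ _ one_pos).ne' measure_ball_lt_top.ne
        rw [integral_const_mul, setAverage_eq, volume_real_closedBall y hR.le, smul_eq_mul]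
        field_simp

/-- The mean value inequality for nonnegative weakly subharmonic functions. -/
theorem exists_mean_value_const (n : ℕ) : ∃ C : ℝ, 0 < C ∧
    ∀ (Ω : Set (EuclideanSpace ℝ (Fin n))) (f : EuclideanSpace ℝ (Fin n) → ℝ)
      (H : EuclideanSpace ℝ (Fin n) → EuclideanSpace ℝ (Fin n)),
      IsOpen Ω → IntegrableOn f Ω → IntegrableOn H Ω → IsWeakGradient Ω f H →
      (∀ φ : EuclideanSpace ℝ (Fin n) → ℝ, ContDiff ℝ ∞ φ → HasCompactSupport φ →
        tsupport φ ⊆ Ω → (∀ x, 0 ≤ φ x) → ∫ x in Ω, inner ℝ (H x) (gradient φ x) ≤ 0) →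
      (∀ x, 0 ≤ f x) →
      ∀ᵐ y ∂(volume.restrict Ω), ∀ t : ℝ, 0 < t → Metric.closedBall y t ⊆ Ω →
        f y ≤ C * (t ^ n)⁻¹ * ∫ x in Metric.closedBall y t, f x := by
  obtain ⟨C, hC0, hC, -⟩ := exists_profile_bound
  have hpos := integral_kernel_pos (n := n)
  refine ⟨C / ∫ x : EuclideanSpace ℝ (Fin n), kernel 0 1 x, by positivity, ?_⟩
  intro Ω f H hΩ hf hH hw hsub hf0
  have hF : Integrable (Ω.indicator f) := (integrable_indicator_iff hΩ.measurableSet).2 hf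
  have hmul : ∀ y R, ∫ x in Ω, f x * kernel y R x = ∫ x, Ω.indicator f x * kernel y R x := by
    intro y R
    rw [← integral_indicator hΩ.measurableSet]
    congr 1 with x : 1
    by_cases hx : x ∈ Ω <;> simp [hx]
  -- The exceptional set depends only on the Lebesgue points of `f` extended by zero, so the bound
  -- holds for all `t` at once.
  filter_upwards [ae_restrict_of_ae (ae_tendsto_kernel_mean hF),
    ae_restrict_mem hΩ.measurableSet] with y hy hyΩ t ht htΩ
  have hmono := monotoneOn_kernel_mean hf hH hw hsub htΩ
  rw [Set.indicator_of_mem hyΩ] at hy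
  have h1 : f y * ∫ x : EuclideanSpace ℝ (Fin n), kernel 0 1 x ≤
      (t ^ n)⁻¹ * ∫ x in Ω, f x * kernel y t x := by
    refine le_of_tendsto hy ?_
    filter_upwards [Ioc_mem_nhdsGT ht] with R hR
    rw [← hmul]
    exact hmono hR ⟨ht, le_rfl⟩ hR.2
  have h2 : ∫ x in Ω, f x * kernel y t x ≤ C * ∫ x in Metric.closedBall y t, f x := by
    have i1 : Integrable (fun x => f x * kernel y t x) (volume.restrict Ω) :=
      integrable_smul_of_hasCompactSupport hf (contDiff_kernel y t).continuous
        (hasCompactSupport_of_closedBall fun x => kernel_of_notMem ht)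
    have e : ∫ x in Ω, f x * kernel y t x = ∫ x in Metric.closedBall y t, f x * kernel y t x :=
      setIntegral_eq_of_subset_of_forall_sdiff_eq_zero hΩ.measurableSet htΩ fun x hx => by
        simp [kernel_of_notMem ht hx.2]
    rw [e, ← integral_const_mul]
    refine integral_mono (i1.mono_measure (Measure.restrict_mono htΩ le_rfl))
      ((hf.mono_set htΩ).const_mul C) fun x => ?_
    rw [mul_comm]
    exact mul_le_mul_of_nonneg_right (hC _ (by positivity)) (hf0 x)
  have h3 : f y * ∫ x : EuclideanSpace ℝ (Fin n), kernel 0 1 x ≤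
      (t ^ n)⁻¹ * (C * ∫ x in Metric.closedBall y t, f x) :=
    h1.trans (mul_le_mul_of_nonneg_left h2 (by positivity))
  rw [← le_div_iff₀ hpos] at h3
  refine h3.trans (le_of_eq ?_)
  ring

/-! ### Competitors near `u` in the metric `d`. -/

theorem metricD_mulCut (u : SobolevMap Ω m) {φ : E → ℝ} (hφ : ContDiff ℝ ∞ φ)
    (hc : HasCompactSupport φ) :
    metricD u (u.mulCut hφ hc) =
      h1Norm Ω (fun x => φ x • u.val x) (fun i x => φ x • u.grad i x + u.val x i • gradient φ x)
        + ∫ x in Ω, |chi u x - chi (u.mulCut hφ hc) x| := by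
  simp only [metricD, SobolevMap.mulCut, sub_sub_cancel]

theorem h1Norm_const_smul (f : E → EuclideanSpace ℝ (Fin m)) (G : Fin m → E → E) (t : ℝ) :
    h1Norm Ω (fun x => t • f x) (fun i x => t • G i x) = |t| * h1Norm Ω f G := by
  have : ∀ x, ‖t • f x‖ ^ 2 + ∑ i, ‖t • G i x‖ ^ 2 =
      t ^ 2 * (‖f x‖ ^ 2 + ∑ i, ‖G i x‖ ^ 2) := by
    intro x
    simp only [norm_smul, mul_pow, Real.norm_eq_abs, sq_abs, ← Finset.mul_sum]
    ring
  simp only [h1Norm, this]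
  rw [integral_const_mul, Real.sqrt_mul (sq_nonneg t), Real.sqrt_sq_eq_abs]

theorem IsAbsoluteMinimizer.isLocalMinimizer {Q : E → ℝ} {g u : SobolevMap Ω m}
    (h : IsAbsoluteMinimizer Q g u) : IsLocalMinimizer Q g u :=
  ⟨h.1, 1, one_pos, fun v hv _ => h.2 v hv⟩

/-- For small `t` the competitor `(1 - t φ) u` has the same positivity set as `u`, so its distance
to `u` is only the `H¹` part, which is `|t|` times a constant. -/
theorem IsLocalMinimizer.firstVar_eq_zero (hΩ : IsOpen Ω) {Q : E → ℝ}
    (hQ : IntegrableOn (fun x => Q x ^ 2) Ω) {g u : SobolevMap Ω m} (h : IsLocalMinimizer Q g u)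
    {φ : E → ℝ} (hφ : ContDiff ℝ ∞ φ) (hc : HasCompactSupport φ) (hs : tsupport φ ⊆ Ω) :
    u.firstVar φ = 0 := by
  obtain ⟨hadm, ε, hε, hmin⟩ := h
  set N := h1Norm Ω (fun x => φ x • u.val x)
    (fun i x => φ x • u.grad i x + u.val x i • gradient φ x) with hN
  have hN0 : 0 ≤ N := Real.sqrt_nonneg _
  refine u.firstVar_eq_zero hQ hφ hc (δ := ε / (N + 1)) (by positivity) fun t ht hsm => ?_
  refine hmin _ (hadm.mulCut hΩ _ _ ((tsupport_mul_subset_right).trans hs)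
    fun x => (le_abs_self _).trans (hsm x).le) ?_
  rw [metricD_mulCut]
  have hz : ∫ x in Ω, |chi u x - chi (u.mulCut
      (contDiff_const.mul hφ : ContDiff ℝ ∞ fun x => t * φ x) hc.mul_left) x| = 0 := by
    refine integral_eq_zero_of_ae (Eventually.of_forall fun x => ?_)
    have : t * φ x ≠ 1 := fun e => by simpa [e] using hsm x
    simp only [chi_mulCut_of_ne_one u (φ := fun x => t * φ x) (contDiff_const.mul hφ)
      hc.mul_left this, sub_self, abs_zero, Pi.zero_apply]
  rw [hz, add_zero]
  have e : h1Norm Ω (fun x => (t * φ x) • u.val x) (fun i x => (t * φ x) • u.grad i x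
      + u.val x i • gradient (fun y => t * φ y) x) = |t| * N := by
    rw [hN, ← h1Norm_const_smul]
    congr 1
    · funext x
      rw [smul_smul]
    · funext i x
      rw [gradient_smooth_const_mul hφ]
      module
  rw [e]
  calc |t| * N ≤ |t| * (N + 1) := by gcongr; linarith
    _ < ε / (N + 1) * (N + 1) := by gcongr
    _ = ε := by field_simp

theorem exists_setIntegral_lt_of_measure_lt {α : Type*} [MeasurableSpace α] {μ : Measure α}
    {f : α → ℝ} (hf : Integrable f μ) {η : ℝ} (hη : 0 < η) :
    ∃ δ : ENNReal, 0 < δ ∧ ∀ s, μ s < δ → ∫ x in s, f x ∂μ < η := by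
  have h := hf.tendsto_setIntegral_nhds_zero (l := comap (fun s : Set α => μ s) (𝓝 0))
    (s := id) tendsto_comap
  have h2 := h.eventually_lt_const hη
  rw [eventually_comap] at h2
  obtain ⟨δ, hδ, hb⟩ := (ENNReal.nhds_zero_basis).eventually_iff.1 h2
  exact ⟨δ, hδ, fun s hs => hb hs s rfl⟩

/-- The distance of `u` to `(1 - φ) u` is controlled by the size of the support of `φ`. -/
theorem metricD_mulCut_le (u : SobolevMap Ω m) {φ : E → ℝ} (hφ : ContDiff ℝ ∞ φ)
    (hc : HasCompactSupport φ) {x : E} {R q : ℝ} (hxR : Metric.closedBall x R ⊆ Ω)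
    (hΩ : IsOpen Ω)
    (hsupp : ∀ z ∉ Metric.closedBall x R, φ z = 0) (h0 : ∀ z, 0 ≤ φ z) (h1 : ∀ z, φ z ≤ 1)
    (hq : ∀ᵐ z ∂(volume.restrict Ω), ‖u.val z‖ * ‖gradient φ z‖ ≤ q) :
    metricD u (u.mulCut hφ hc) ≤
      Real.sqrt ((∫ z in Metric.closedBall x R, (‖u.val z‖ ^ 2 + 2 * u.gradSq z)) +
        2 * q ^ 2 * volume.real (Metric.closedBall x R)) +
        volume.real (Metric.closedBall x R) := by
  have hgrad : ∀ z ∉ Metric.closedBall x R, gradient φ z = 0 := fun z hz =>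
    gradient_eq_zero_of_notMem_tsupport fun h => hz (tsupport_subset_closedBall hsupp h)
  have hfin : volume (Metric.closedBall x R) ≠ ⊤ := measure_closedBall_lt_top.ne
  have hconst : ∀ a : ℝ, IntegrableOn (fun _ : E => a) (Metric.closedBall x R) := fun a =>
    integrableOn_const hfin
  have iu : IntegrableOn (fun z => ‖u.val z‖ ^ 2 + 2 * u.gradSq z) (Metric.closedBall x R) :=
    ((integrable_norm_sq u.memLp_val).add (u.integrable_gradSq.const_mul 2)).mono_measure
      (Measure.restrict_mono hxR le_rfl)
  rw [metricD_mulCut]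
  refine add_le_add (Real.sqrt_le_sqrt ?_) ?_
  · rw [setIntegral_eq_of_subset_of_forall_sdiff_eq_zero hΩ.measurableSet hxR
      fun z hz => by simp [hsupp z hz.2, hgrad z hz.2]]
    have e : 2 * q ^ 2 * volume.real (Metric.closedBall x R) =
        ∫ _z in Metric.closedBall x R, 2 * q ^ 2 := by
      rw [setIntegral_const, smul_eq_mul, mul_comm]
    rw [e, ← integral_add iu (hconst _)]
    refine integral_mono_ae ?_ (iu.add (hconst _)) ?_
    · exact (integrable_h1 (memLp_smul_left hφ.continuous hc u.memLp_val)
        (fun i => memLp_weakGradient_mul (u.memLp_coord i) (u.memLp_grad i) hφ hc)).mono_set hxR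
    · filter_upwards [ae_restrict_of_ae_restrict_of_subset hxR hq] with z hz
      -- With `0 ≤ φ ≤ 1`, summing over `i` bounds the energy density of `φ u` by `2 |∇u|² + 2 q²`.
      have hi : ∀ i, ‖φ z • u.grad i z + u.val z i • gradient φ z‖ ^ 2 ≤
          2 * ‖u.grad i z‖ ^ 2 + 2 * (u.val z i ^ 2 * ‖gradient φ z‖ ^ 2) := by
        intro i
        have h2 := norm_sub_sq_le (φ z • u.grad i z) (-(u.val z i • gradient φ z))
        rw [sub_neg_eq_add, norm_neg, norm_smul, norm_smul, mul_pow, mul_pow, Real.norm_eq_abs,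
          Real.norm_eq_abs, sq_abs, sq_abs] at h2
        have h3 : φ z ^ 2 ≤ 1 := pow_le_one₀ (h0 z) (h1 z)
        nlinarith [sq_nonneg ‖u.grad i z‖]
      have hs := Finset.sum_le_sum fun i (_ : i ∈ Finset.univ) => hi i
      rw [Finset.sum_add_distrib, ← Finset.mul_sum, ← Finset.mul_sum, ← Finset.sum_mul,
        ← EuclideanSpace.real_norm_sq_eq] at hs
      have hval : ‖φ z • u.val z‖ ^ 2 ≤ ‖u.val z‖ ^ 2 := by
        rw [norm_smul, Real.norm_of_nonneg (h0 z)]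
        exact pow_le_pow_left₀ (mul_nonneg (h0 z) (norm_nonneg _))
          (mul_le_of_le_one_left (norm_nonneg _) (h1 z)) 2
      have hq2 : ‖u.val z‖ ^ 2 * ‖gradient φ z‖ ^ 2 ≤ q ^ 2 := by
        rw [← mul_pow]
        gcongr
      simp only [SobolevMap.gradSq]
      linarith
  · rw [setIntegral_eq_of_subset_of_forall_sdiff_eq_zero hΩ.measurableSet hxR fun z hz => by
      rw [chi_mulCut_of_ne_one u hφ hc (by rw [hsupp z hz.2]; exact zero_ne_one), sub_self,
        abs_zero]]
    calc _ ≤ ∫ _z in Metric.closedBall x R, (1 : ℝ) := by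
          refine integral_mono_of_nonneg (Eventually.of_forall fun z => abs_nonneg _) (hconst 1)
            (Eventually.of_forall fun z => ?_)
          have a1 := chi_mulCut_le u hφ hc z
          have a2 := chi_le_one u z
          have a3 := chi_nonneg (u.mulCut hφ hc) z
          change |_| ≤ (1 : ℝ)
          rw [abs_of_nonneg (by linarith)]
          linarith
      _ = _ := by rw [setIntegral_const, smul_eq_mul, mul_one]

/-- Absolute continuity of the integral makes the bound of `metricD_mulCut_le` small on every ball
of small measure, hence uniformly in the centre. -/
theorem exists_radius_metricD_lt (hn : 1 ≤ n) (hΩ : IsOpen Ω) (u : SobolevMap Ω m) (q : ℝ) {ε : ℝ}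
    (hε : 0 < ε) : ∃ r₀ : ℝ, 0 < r₀ ∧ ∀ (x : E) (R : ℝ), 0 ≤ R → R ≤ r₀ →
      Metric.closedBall x R ⊆ Ω →
      ∀ (φ : E → ℝ) (hφ : ContDiff ℝ ∞ φ) (hc : HasCompactSupport φ),
        (∀ z ∉ Metric.closedBall x R, φ z = 0) → (∀ z, 0 ≤ φ z) → (∀ z, φ z ≤ 1) →
        (∀ᵐ z ∂(volume.restrict Ω), ‖u.val z‖ * ‖gradient φ z‖ ≤ q) →
        metricD u (u.mulCut hφ hc) < ε := by
  have iu : Integrable (fun z => ‖u.val z‖ ^ 2 + 2 * u.gradSq z) (volume.restrict Ω) :=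
    (integrable_norm_sq u.memLp_val).add (u.integrable_gradSq.const_mul 2)
  -- The two terms under the root get `(ε / 2)² / 2` each; the volume term outside gets `ε / 2`.
  obtain ⟨δ, hδ, hI⟩ := exists_setIntegral_lt_of_measure_lt iu
    (show 0 < (ε / 2) ^ 2 / 2 by positivity)
  set v := volume.real (Metric.ball (0 : E) 1) with hv
  have ht : Tendsto (fun R : ℝ => R ^ n * v) (𝓝 0) (𝓝 0) := by
    have : Continuous fun R : ℝ => R ^ n * v := by fun_prop
    have := this.tendsto 0
    rwa [zero_pow (by omega), zero_mul] at this
  have ht2 : Tendsto (fun R : ℝ => ENNReal.ofReal (R ^ n * v)) (𝓝 0) (𝓝 0) := by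
    rw [← ENNReal.ofReal_zero]
    exact (ENNReal.continuous_ofReal.tendsto 0).comp ht
  have ht3 : Tendsto (fun R : ℝ => 2 * q ^ 2 * (R ^ n * v)) (𝓝 0) (𝓝 0) := by
    simpa using ht.const_mul (2 * q ^ 2)
  have hev := ((ht.eventually_lt_const (show 0 < ε / 2 by positivity)).and
    (ht2.eventually_lt_const hδ)).and
    (ht3.eventually_lt_const (show 0 < (ε / 2) ^ 2 / 2 by positivity))
  obtain ⟨r₁, hr₁, hb⟩ := Metric.eventually_nhds_iff.1 hev
  refine ⟨r₁ / 2, by positivity, fun x R hR0 hR hxR φ hφ hc hs h0 h1 hq => ?_⟩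
  obtain ⟨⟨b1, b2⟩, b3⟩ := hb (y := R) (by
    rw [Real.dist_eq, sub_zero, abs_of_nonneg hR0]; linarith)
  rw [hv, ← volume_real_closedBall x hR0] at b1 b2 b3
  rw [measureReal_def, ENNReal.ofReal_toReal measure_closedBall_lt_top.ne] at b2
  have hI' := hI (Metric.closedBall x R) ((Measure.restrict_apply_le _ _).trans_lt b2)
  rw [Measure.restrict_restrict Metric.isClosed_closedBall.measurableSet,
    Set.inter_eq_left.2 hxR] at hI'
  refine (metricD_mulCut_le u hφ hc hxR hΩ hs h0 h1 hq).trans_lt ?_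
  have : Real.sqrt ((∫ z in Metric.closedBall x R, (‖u.val z‖ ^ 2 + 2 * u.gradSq z)) +
        2 * q ^ 2 * volume.real (Metric.closedBall x R)) < ε / 2 := by
    rw [Real.sqrt_lt' (by positivity)]
    linarith
  linarith

/-! ### Cutoff functions. -/

theorem exists_deriv_smoothTransition_bound :
    ∃ C, 0 < C ∧ ∀ t, |deriv Real.smoothTransition t| ≤ C := by
  have hc : Continuous (deriv Real.smoothTransition) :=
    (Real.smoothTransition.contDiff (n := ⊤)).continuous_deriv (by simp)
  obtain ⟨C, hC⟩ := (isCompact_Icc (a := (0 : ℝ)) (b := 1)).exists_bound_of_continuousOn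
    hc.continuousOn
  refine ⟨max 1 C, by positivity, fun t => ?_⟩
  by_cases ht : t ∈ Set.Icc (0 : ℝ) 1
  · exact (hC t ht).trans (le_max_right _ _)
  · have : deriv Real.smoothTransition t = 0 := by
      rw [Set.mem_Icc, not_and_or, not_le, not_le] at ht
      rcases ht with h | h
      · have : Real.smoothTransition =ᶠ[𝓝 t] fun _ => 0 := by
          filter_upwards [Iio_mem_nhds h] with s hs
          exact Real.smoothTransition.zero_of_nonpos (Set.mem_Iio.1 hs).le
        rw [this.deriv_eq, deriv_const]
      · have : Real.smoothTransition =ᶠ[𝓝 t] fun _ => 1 := by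
          filter_upwards [Ioi_mem_nhds h] with s hs
          exact Real.smoothTransition.one_of_one_le (Set.mem_Ioi.1 hs).le
        rw [this.deriv_eq, deriv_const]
    rw [this, abs_zero]
    positivity

/-- Cutoff functions between concentric balls with the natural gradient bound. -/
theorem exists_cutoff_const : ∃ C : ℝ, 0 < C ∧ ∀ (n : ℕ) (x : EuclideanSpace ℝ (Fin n)) (s R : ℝ),
    0 < s → s < R → ∃ φ : EuclideanSpace ℝ (Fin n) → ℝ, ContDiff ℝ ∞ φ ∧ (∀ z, 0 ≤ φ z) ∧
      (∀ z, φ z ≤ 1) ∧ (∀ z ∈ Metric.closedBall x s, φ z = 1) ∧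
      (∀ z ∉ Metric.closedBall x R, φ z = 0) ∧ ∀ z, ‖gradient φ z‖ ≤ C / (R - s) := by
  obtain ⟨C, hC0, hC⟩ := exists_deriv_smoothTransition_bound
  refine ⟨2 * C, by positivity, fun n x s R hs hsR => ?_⟩
  have hd : 0 < R ^ 2 - s ^ 2 := by nlinarith
  have hRs : 0 < R - s := by linarith
  -- Interpolation in `|z - x|²` rather than `|z - x|` keeps the cutoff smooth at the centre. The
  -- gradient then carries `2 R / (R² - s²) ≤ 2 / (R - s)`.
  set f : EuclideanSpace ℝ (Fin n) → ℝ :=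
    fun z => (R ^ 2 - s ^ 2)⁻¹ * (R ^ 2 - ‖z - x‖ ^ 2) with hf
  have hq : ContDiff ℝ ∞ fun z : EuclideanSpace ℝ (Fin n) => ‖z - x‖ ^ 2 :=
    (contDiff_id.sub contDiff_const).norm_sq ℝ
  have hfs : ContDiff ℝ ∞ f := contDiff_const.mul (contDiff_const.sub hq)
  have h0 : ∀ z ∉ Metric.closedBall x R, Real.smoothTransition (f z) = 0 := by
    intro z hz
    rw [Metric.mem_closedBall, not_le, dist_eq_norm] at hz
    refine Real.smoothTransition.zero_of_nonpos
      (mul_nonpos_of_nonneg_of_nonpos (by positivity) ?_)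
    nlinarith
  refine ⟨fun z => Real.smoothTransition (f z),
    (Real.smoothTransition.contDiff (n := ⊤)).comp hfs,
    fun z => Real.smoothTransition.nonneg _, fun z => Real.smoothTransition.le_one _, ?_, h0, ?_⟩
  · intro z hz
    rw [Metric.mem_closedBall, dist_eq_norm] at hz
    refine Real.smoothTransition.one_of_one_le ?_
    change 1 ≤ (R ^ 2 - s ^ 2)⁻¹ * _
    rw [← div_eq_inv_mul, one_le_div hd]
    nlinarith [norm_nonneg (z - x)]
  · intro z
    by_cases hz : z ∈ Metric.closedBall x R
    · rw [Metric.mem_closedBall, dist_eq_norm] at hz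
      have hqd := hq.differentiable (by simp) z
      have hg : gradient f z = (R ^ 2 - s ^ 2)⁻¹ • (-((2 : ℝ) • (z - x))) := by
        rw [hf, gradient_const_mul (f := fun z => R ^ 2 - ‖z - x‖ ^ 2)
          ((differentiableAt_const _).sub hqd), gradient_sub (f := fun _ => R ^ 2)
          (differentiableAt_const _) hqd, gradient_fun_const, zero_sub, gradient_norm_sub_sq]
      rw [gradient_comp ((Real.smoothTransition.contDiff (n := 1)).differentiable
        (by simp) _).hasDerivAt (hfs.differentiable (by simp) z), hg, norm_smul, norm_smul,
        norm_neg, norm_smul, Real.norm_eq_abs, Real.norm_of_nonneg (inv_nonneg.2 hd.le),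
        Real.norm_of_nonneg (zero_le_two (α := ℝ))]
      calc _ ≤ C * ((R ^ 2 - s ^ 2)⁻¹ * (2 * R)) := by gcongr; exact hC _
        _ = 2 * C * (R / ((R - s) * (R + s))) := by
          rw [show R ^ 2 - s ^ 2 = (R - s) * (R + s) by ring]; field_simp
        _ ≤ 2 * C * (1 / (R - s)) := by
          refine mul_le_mul_of_nonneg_left ?_ (by positivity)
          rw [div_le_div_iff₀ (mul_pos hRs (by linarith)) hRs]
          nlinarith
        _ = _ := by ring
    · rw [gradient_eq_zero_of_notMem_tsupport fun h => hz (tsupport_subset_closedBall h0 h),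
        norm_zero]
      positivity

/-! ### Nonlinear decay and its iteration. -/

/-- For `φ ≥ 0` the vanishing first variation gives `∫ ∇(|u|² / 2) · ∇φ = -∫ φ |∇u|² ≤ 0`, so `|u|²`
is weakly subharmonic. -/
theorem exists_normSq_mean_value_const (n : ℕ) : ∃ C : ℝ, 0 < C ∧
    ∀ (m : ℕ) (Ω : Set (EuclideanSpace ℝ (Fin n))) (u : SobolevMap Ω m), IsOpen Ω →
      (∀ φ : EuclideanSpace ℝ (Fin n) → ℝ, ContDiff ℝ ∞ φ → HasCompactSupport φ →
        tsupport φ ⊆ Ω → u.firstVar φ = 0) →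
      ∀ᵐ y ∂(volume.restrict Ω), ∀ t : ℝ, 0 < t → Metric.closedBall y t ⊆ Ω →
        ‖u.val y‖ ^ 2 ≤ C * (t ^ n)⁻¹ * ∫ x in Metric.closedBall y t, ‖u.val x‖ ^ 2 := by
  obtain ⟨C, hC0, hC⟩ := exists_mean_value_const n
  refine ⟨C, hC0, fun m Ω u hΩ hvar => ?_⟩
  refine hC Ω (fun x => ‖u.val x‖ ^ 2) (fun x => (2 : ℝ) • u.cross x) hΩ
    (integrable_norm_sq u.memLp_val) (Integrable.smul (2 : ℝ) u.integrable_cross) ?_ ?_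
    (fun x => by positivity)
  · intro φ hφ hc hs
    rw [u.integral_normSq_smul_gradient hΩ hφ hc hs, neg_smul, ← integral_smul]
    congr 2 with x : 1
    rw [smul_comm]
  · intro φ hφ hc hs h0
    have h := hvar φ hφ hc hs
    have i1 := integrable_mul_of_hasCompactSupport hφ.continuous hc u.integrable_gradSq
    rw [SobolevMap.firstVar, integral_add i1 (u.integrable_inner_cross hφ hc)] at h
    have hpos : 0 ≤ ∫ x in Ω, φ x * u.gradSq x := integral_nonneg fun x =>
      mul_nonneg (h0 x) (Finset.sum_nonneg fun i _ => by positivity)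
    simp only [real_inner_smul_left]
    rw [integral_const_mul]
    linarith

/-- `u` has at most the energy of its competitors `(1 - φ) u` for cutoff functions `φ` in `B_r(x)`
with `|u| |∇φ| ≤ q`. -/
def MinimizesCutoffs (Q : E → ℝ) (u : SobolevMap Ω m) (x : E) (r q : ℝ) : Prop :=
  ∀ (R : ℝ) (φ : E → ℝ) (hφ : ContDiff ℝ ∞ φ) (hc : HasCompactSupport φ), 0 ≤ R → R < r →
    (∀ z ∉ Metric.closedBall x R, φ z = 0) → (∀ z, 0 ≤ φ z) → (∀ z, φ z ≤ 1) →
    (∀ᵐ z ∂(volume.restrict Ω), ‖u.val z‖ * ‖gradient φ z‖ ≤ q) →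
    energy Q u ≤ energy Q (u.mulCut hφ hc)

/-- The measure of `{|u| > 0}` is controlled in a smaller ball. -/
theorem integral_chi_le {Q : E → ℝ} {q : ℝ} (hΩ : IsOpen Ω) (hq : 0 < q)
    (hQ : IntegrableOn (fun x => Q x ^ 2) Ω) (hQq : ∀ᵐ x ∂(volume.restrict Ω), q ≤ Q x)
    (u : SobolevMap Ω m)
    (hvar : ∀ φ : E → ℝ, ContDiff ℝ ∞ φ → HasCompactSupport φ → tsupport φ ⊆ Ω → u.firstVar φ = 0)
    {x : E} {s R M D : ℝ} (hR : 0 ≤ R) (hRΩ : Metric.closedBall x R ⊆ Ω)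
    (hsR : s ≤ R)
    (hM : ∀ᵐ z ∂(volume.restrict (Metric.closedBall x R)), ‖u.val z‖ ≤ M)
    {φ : E → ℝ} (hφ : ContDiff ℝ ∞ φ) (hc : HasCompactSupport φ)
    (hφ1 : ∀ z ∈ Metric.closedBall x s, φ z = 1) (hφ0 : ∀ z ∉ Metric.closedBall x R, φ z = 0)
    (hD : ∀ z, ‖gradient φ z‖ ≤ D) (hmin : energy Q u ≤ energy Q (u.mulCut hφ hc)) :
    q ^ 2 * ∫ z in Metric.closedBall x s, chi u z ≤
      M ^ 2 * D ^ 2 * (R ^ n * volume.real (Metric.ball (0 : E) 1)) := by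
  have hsub : tsupport φ ⊆ Ω := (tsupport_subset_closedBall hφ0).trans hRΩ
  have hsΩ : Metric.closedBall x s ⊆ Ω := (Metric.closedBall_subset_closedBall hsR).trans hRΩ
  have hgrad : ∀ z ∉ Metric.closedBall x R, gradient φ z = 0 := fun z hz =>
    gradient_eq_zero_of_notMem_tsupport fun h => hz (tsupport_subset_closedBall hφ0 h)
  have hv := hvar (fun z => φ z * (2 - φ z)) (hφ.mul (contDiff_const.sub hφ)) hc.mul_right
    ((tsupport_mul_subset_left).trans hsub)
  have key := u.weight_le_of_energy_le hQ hφ hc hv hmin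
  have i3 : IntegrableOn (fun x => Q x ^ 2 * (chi u x - chi (u.mulCut hφ hc) x)) Ω := by
    simp only [mul_sub]
    exact (integrable_weight_chi hQ u).sub (integrable_weight_chi hQ _)
  have ichi : IntegrableOn (chi u) (Metric.closedBall x s) := by
    refine Integrable.mono' (integrableOn_const (C := (1 : ℝ)) measure_closedBall_lt_top.ne)
      ((aestronglyMeasurable_chi u).mono_measure (Measure.restrict_mono hsΩ le_rfl))
      (Eventually.of_forall fun z => ?_)
    rw [Real.norm_of_nonneg (chi_nonneg u z)]
    exact chi_le_one u z
  calc q ^ 2 * ∫ z in Metric.closedBall x s, chi u z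
      = ∫ z in Metric.closedBall x s, q ^ 2 * chi u z := (integral_const_mul _ _).symm
    _ ≤ ∫ z in Metric.closedBall x s, Q z ^ 2 * (chi u z - chi (u.mulCut hφ hc) z) := by
        refine integral_mono_ae (ichi.const_mul _) (i3.mono_set hsΩ) ?_
        filter_upwards [ae_restrict_of_ae_restrict_of_subset hsΩ hQq,
          ae_restrict_mem Metric.isClosed_closedBall.measurableSet] with z hz hzs
        rw [chi_mulCut_of_eq_one u hφ hc (hφ1 z hzs), sub_zero]
        have := chi_nonneg u z
        gcongr
    _ ≤ ∫ z in Ω, Q z ^ 2 * (chi u z - chi (u.mulCut hφ hc) z) := by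
        refine setIntegral_mono_set i3 (Eventually.of_forall fun z => ?_)
          (LE.le.eventuallyLE hsΩ)
        exact mul_nonneg (sq_nonneg _) (sub_nonneg.2 (chi_mulCut_le u hφ hc z))
    _ ≤ ∫ z in Ω, ‖u.val z‖ ^ 2 * ‖gradient φ z‖ ^ 2 := key
    _ = ∫ z in Metric.closedBall x R, ‖u.val z‖ ^ 2 * ‖gradient φ z‖ ^ 2 :=
        setIntegral_eq_of_subset_of_forall_sdiff_eq_zero hΩ.measurableSet hRΩ fun z hz => by
          simp [hgrad z hz.2]
    _ ≤ ∫ _z in Metric.closedBall x R, M ^ 2 * D ^ 2 := by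
        refine integral_mono_ae ((u.integrable_normSq_mul hφ hc).mono_set hRΩ)
          (integrableOn_const measure_closedBall_lt_top.ne) ?_
        filter_upwards [hM] with z hz
        have := hD z
        gcongr
    _ = _ := by
        rw [setIntegral_const, smul_eq_mul, mul_comm, volume_real_closedBall x hR]

/-- The nonlinear decay estimate: the bound on the smaller ball is quadratic in `M`. -/
theorem exists_decay_const (n : ℕ) : ∃ C₀ C₁ : ℝ, 0 < C₀ ∧ 0 < C₁ ∧
    ∀ (m : ℕ) (Ω : Set (EuclideanSpace ℝ (Fin n))) (u : SobolevMap Ω m)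
      (Q : EuclideanSpace ℝ (Fin n) → ℝ) (q : ℝ), IsOpen Ω → 0 < q →
      IntegrableOn (fun x => Q x ^ 2) Ω → (∀ᵐ x ∂(volume.restrict Ω), q ≤ Q x) →
      (∀ φ : EuclideanSpace ℝ (Fin n) → ℝ, ContDiff ℝ ∞ φ → HasCompactSupport φ →
        tsupport φ ⊆ Ω → u.firstVar φ = 0) →
      ∀ (x : EuclideanSpace ℝ (Fin n)) (r : ℝ), Metric.ball x r ⊆ Ω →
      MinimizesCutoffs Q u x r q →
      ∀ R t M M' : ℝ, 0 < t → 2 * t < R → R < r → 0 ≤ M → 0 ≤ M' →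
        (∀ᵐ z ∂(volume.restrict (Metric.closedBall x R)), ‖u.val z‖ ≤ M) →
        C₀ * M ≤ q * t → C₁ * M ^ 4 * R ^ n ≤ M' ^ 2 * t ^ (n + 2) * q ^ 2 →
        ∀ᵐ z ∂(volume.restrict (Metric.closedBall x (R - 2 * t))), ‖u.val z‖ ≤ M' := by
  obtain ⟨C₀, hC₀, hcut⟩ := exists_cutoff_const
  obtain ⟨C, hC, hmean⟩ := exists_normSq_mean_value_const n
  set v := volume.real (Metric.ball (0 : EuclideanSpace ℝ (Fin n)) 1) with hvdef
  have hv : 0 < v :=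
    ENNReal.toReal_pos (Metric.measure_ball_pos _ _ one_pos).ne' measure_ball_lt_top.ne
  refine ⟨C₀, C * C₀ ^ 2 * v, hC₀, by positivity, ?_⟩
  intro m Ω u Q q hΩ hq hQ hQq hvar x r hxr hmin R t M M' ht htR hRr hM0 hM'0 hM h1 h2
  have hRΩ : Metric.closedBall x R ⊆ Ω := (Metric.closedBall_subset_ball hRr).trans hxr
  have hsR : R - t ≤ R := by linarith
  have hsΩ : Metric.closedBall x (R - t) ⊆ Ω :=
    (Metric.closedBall_subset_closedBall hsR).trans hRΩ
  obtain ⟨φ, hφ, hφn, hφl, hφ1, hφ0, hD⟩ := hcut n x (R - t) R (by linarith) (by linarith)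
  rw [sub_sub_cancel] at hD
  have hc : HasCompactSupport φ := hasCompactSupport_of_closedBall hφ0
  -- The assumption `C₀ M ≤ q t` is what makes this cutoff one of those tested in
  -- `MinimizesCutoffs`.
  have hsmall : ∀ᵐ z ∂(volume.restrict Ω), ‖u.val z‖ * ‖gradient φ z‖ ≤ q := by
    have hM2 := (ae_restrict_iff' Metric.isClosed_closedBall.measurableSet).1 hM
    filter_upwards [ae_restrict_of_ae hM2] with z hz
    by_cases hzR : z ∈ Metric.closedBall x R
    · calc ‖u.val z‖ * ‖gradient φ z‖ ≤ M * (C₀ / t) :=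
            mul_le_mul (hz hzR) (hD z) (norm_nonneg _) hM0
        _ = C₀ * M / t := by ring
        _ ≤ q := by rwa [div_le_iff₀ ht]
    · rw [gradient_eq_zero_of_notMem_tsupport fun h => hzR (tsupport_subset_closedBall hφ0 h),
        norm_zero, mul_zero]
      exact hq.le
  have hA := integral_chi_le hΩ hq hQ hQq u hvar (by linarith) hRΩ hsR hM hφ hc hφ1 hφ0 hD
    (hmin R φ hφ hc (by linarith) hRr hφ0 hφn hφl hsmall)
  set A := ∫ z in Metric.closedBall x (R - t), chi u z with hAdef
  have iu : IntegrableOn (fun z => ‖u.val z‖ ^ 2) (Metric.closedBall x (R - t)) :=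
    IntegrableOn.mono_set (integrable_norm_sq u.memLp_val) hsΩ
  -- Since `|u|² ≤ M² χ`, the measure bound, already of order `M²`, enters with a second factor
  -- `M²`.
  have hint : ∫ z in Metric.closedBall x (R - t), ‖u.val z‖ ^ 2 ≤ M ^ 2 * A := by
    rw [hAdef, ← integral_const_mul]
    have ichi : IntegrableOn (chi u) (Metric.closedBall x (R - t)) := by
      refine Integrable.mono' (integrableOn_const (C := (1 : ℝ)) measure_closedBall_lt_top.ne)
        ((aestronglyMeasurable_chi u).mono_measure (Measure.restrict_mono hsΩ le_rfl))
        (Eventually.of_forall fun z => ?_)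
      rw [Real.norm_of_nonneg (chi_nonneg u z)]
      exact chi_le_one u z
    refine integral_mono_ae iu (ichi.const_mul _) ?_
    filter_upwards [ae_restrict_of_ae_restrict_of_subset
      (Metric.closedBall_subset_closedBall hsR) hM] with z hz
    by_cases h0 : u.val z = 0
    · simp [h0, chi_of_eq_zero h0]
    · rw [chi_of_ne_zero h0, mul_one]
      gcongr
  have hsub : Metric.closedBall x (R - 2 * t) ⊆ Ω :=
    (Metric.closedBall_subset_closedBall (by linarith)).trans hRΩ
  filter_upwards [ae_restrict_of_ae_restrict_of_subset hsub (hmean m Ω u hΩ hvar),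
    ae_restrict_mem Metric.isClosed_closedBall.measurableSet] with y hy hyx
  have hyt : Metric.closedBall y t ⊆ Metric.closedBall x (R - t) := by
    refine Metric.closedBall_subset_closedBall' ?_
    have := Metric.mem_closedBall.1 hyx
    linarith
  have h3 := hy t ht (hyt.trans hsΩ)
  have h4 : ∫ z in Metric.closedBall y t, ‖u.val z‖ ^ 2 ≤
      ∫ z in Metric.closedBall x (R - t), ‖u.val z‖ ^ 2 :=
    setIntegral_mono_set iu (Eventually.of_forall fun z => by positivity)
      (LE.le.eventuallyLE hyt)
  have h5 : A ≤ M ^ 2 * (C₀ / t) ^ 2 * (R ^ n * v) / q ^ 2 := by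
    rw [le_div_iff₀ (by positivity)]
    linarith
  have htn : 0 < t ^ n := pow_pos ht n
  refine le_of_sq_le_sq ?_ hM'0
  calc ‖u.val y‖ ^ 2 ≤ C * (t ^ n)⁻¹ * (M ^ 2 * (M ^ 2 * (C₀ / t) ^ 2 * (R ^ n * v) / q ^ 2)) := by
        refine h3.trans ?_
        gcongr
        exact h4.trans (hint.trans (by gcongr))
    _ = C * C₀ ^ 2 * v * M ^ 4 * R ^ n / (t ^ (n + 2) * q ^ 2) := by
        field_simp
        ring
    _ ≤ M' ^ 2 := by
        rw [div_le_iff₀ (by positivity)]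
        linarith

/-- Iterating the decay estimate: a small linear bound in `B_r(x)` forces `u` to vanish in the
smaller ball. -/
theorem exists_vanishing_const (n : ℕ) : ∃ c : ℝ → ℝ, (∀ ρ : ℝ, ρ < 1 → 0 < c ρ) ∧
    ∀ (m : ℕ) (Ω : Set (EuclideanSpace ℝ (Fin n))) (u : SobolevMap Ω m)
      (Q : EuclideanSpace ℝ (Fin n) → ℝ) (q : ℝ), IsOpen Ω → 0 < q →
      IntegrableOn (fun x => Q x ^ 2) Ω → (∀ᵐ x ∂(volume.restrict Ω), q ≤ Q x) →
      (∀ φ : EuclideanSpace ℝ (Fin n) → ℝ, ContDiff ℝ ∞ φ → HasCompactSupport φ →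
        tsupport φ ⊆ Ω → u.firstVar φ = 0) →
      ∀ (x : EuclideanSpace ℝ (Fin n)) (r : ℝ), 0 < r → Metric.ball x r ⊆ Ω →
      MinimizesCutoffs Q u x r q →
      ∀ ρ : ℝ, 0 < ρ → ρ < 1 →
        (∀ᵐ z ∂(volume.restrict (Metric.ball x r)), ‖u.val z‖ ≤ c ρ * q * r) →
        ∀ᵐ z ∂(volume.restrict (Metric.closedBall x (r * (1 - (1 - ρ) / 2)))), u.val z = 0 := by
  obtain ⟨C₀, C₁, hC₀, hC₁, hstep⟩ := exists_decay_const n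
  -- The steps `t` will shrink like `2^{-k}`, so `t ^ (n + 2)` shrinks like `b ^ k`; with this ratio
  -- the decay condition compares `b ^ (4 k)` with `b ^ (3 k + 2)`.
  set b : ℝ := (1 / 2) ^ (n + 2) with hb
  have hb0 : 0 < b := by positivity
  have hb2 : b ≤ 1 / 2 := by
    rw [hb, pow_succ]
    exact mul_le_of_le_one_left (by norm_num) (pow_le_one₀ (by norm_num) (by norm_num))
  -- The three entries give `c ≤ 1`, the smallness condition with `C₀`, and the decay condition with
  -- `C₁`.
  refine ⟨fun ρ => min (min 1 ((1 - ρ) / 16 / C₀)) (b ^ 2 * ((1 - ρ) / 16) ^ (n + 2) / C₁), ?_, ?_⟩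
  · intro ρ hρ
    have : 0 < 1 - ρ := by linarith
    positivity
  intro m Ω u Q q hΩ hq hQ hQq hvar x r hr hxr hmin ρ hρ0 hρ hsmall
  set a : ℝ := 1 - ρ with ha
  have ha0 : 0 < a := by linarith
  have ha1 : a < 1 := by linarith
  set c : ℝ := min (min 1 (a / 16 / C₀)) (b ^ 2 * (a / 16) ^ (n + 2) / C₁) with hc
  have hc0 : 0 < c := by positivity
  have hc1 : c ≤ 1 := (min_le_left _ _).trans (min_le_left _ _)
  have hcC₀ : C₀ * c ≤ a / 16 := by
    rw [mul_comm, ← le_div_iff₀ hC₀]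
    exact (min_le_left _ _).trans (min_le_right _ _)
  have hcC₁ : C₁ * c ≤ b ^ 2 * (a / 16) ^ (n + 2) := by
    rw [mul_comm, ← le_div_iff₀ hC₁]
    exact min_le_right _ _
  -- The radii decrease from `r (1 - a / 4)` to `r (1 - a / 2)`, which still exceeds `ρ r`;
  -- consecutive ones differ by `2 t` with `t = r (a / 16) 2^{-k}`.
  set Rad : ℕ → ℝ := fun k => r * (1 - a / 2 + a / 4 * (1 / 2) ^ k) with hRad
  have hpow : ∀ k : ℕ, (0 : ℝ) < (1 / 2) ^ k ∧ ((1 : ℝ) / 2) ^ k ≤ 1 := fun k =>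
    ⟨by positivity, pow_le_one₀ (by norm_num) (by norm_num)⟩
  have hRad1 : ∀ k, Rad k < r := by
    intro k
    have := hpow k
    have h1 : 1 - a / 2 + a / 4 * (1 / 2) ^ k < 1 := by nlinarith
    calc Rad k < r * 1 := mul_lt_mul_of_pos_left h1 hr
      _ = r := mul_one r
  have hiter : ∀ k : ℕ, ∀ᵐ z ∂(volume.restrict (Metric.closedBall x (Rad k))),
      ‖u.val z‖ ≤ c * q * r * b ^ k := by
    intro k
    induction k with
    | zero =>
      rw [pow_zero, mul_one]
      exact ae_restrict_of_ae_restrict_of_subset (Metric.closedBall_subset_ball (hRad1 0)) hsmall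
    | succ k ih =>
      have hk := hpow k
      set t : ℝ := r * (a / 16) * (1 / 2) ^ k with ht
      have ht0 : 0 < t := by positivity
      have hRk : Rad (k + 1) = Rad k - 2 * t := by
        simp only [hRad, ht, pow_succ]
        ring
      have hbk : b ^ k ≤ (1 / 2) ^ k := by gcongr
      rw [hRk]
      refine hstep m Ω u Q q hΩ hq hQ hQq hvar x r hxr hmin (Rad k) t (c * q * r * b ^ k)
        (c * q * r * b ^ (k + 1)) ht0 ?_ (hRad1 k) (by positivity) (by positivity) ih ?_ ?_
      · have h1 : 2 * (a / 16 * (1 / 2) ^ k) < 1 - a / 2 + a / 4 * (1 / 2) ^ k := by nlinarith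
        calc 2 * t = r * (2 * (a / 16 * (1 / 2) ^ k)) := by rw [ht]; ring
          _ < Rad k := mul_lt_mul_of_pos_left h1 hr
      · calc C₀ * (c * q * r * b ^ k) = (C₀ * c) * b ^ k * (q * r) := by ring
          _ ≤ a / 16 * (1 / 2) ^ k * (q * r) := by gcongr
          _ = q * t := by rw [ht]; ring
      · have hRk0 : 0 ≤ Rad k := by
          have : 0 ≤ 1 - a / 2 + a / 4 * (1 / 2) ^ k := by nlinarith
          exact mul_nonneg hr.le this
        have e : t ^ (n + 2) = r ^ (n + 2) * (a / 16) ^ (n + 2) * b ^ k := by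
          rw [ht, mul_pow, mul_pow, hb, ← pow_mul, ← pow_mul, mul_comm k]
        calc C₁ * (c * q * r * b ^ k) ^ 4 * Rad k ^ n
            ≤ C₁ * (c * q * r * b ^ k) ^ 4 * r ^ n := by gcongr; exact (hRad1 k).le
          -- Of the fourth power, one factor `c` absorbs `C₁`, one factor `c b ^ k` is at most `1`,
          -- and the rest matches the right-hand side.
          _ = (C₁ * c) * (c * b ^ k) * (c ^ 2 * b ^ (3 * k) * q ^ 4 * r ^ (n + 4)) := by ring
          _ ≤ (b ^ 2 * (a / 16) ^ (n + 2)) * (1 * 1) *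
              (c ^ 2 * b ^ (3 * k) * q ^ 4 * r ^ (n + 4)) := by
              gcongr
              exact pow_le_one₀ hb0.le (by linarith)
          _ = (c * q * r * b ^ (k + 1)) ^ 2 * (r ^ (n + 2) * (a / 16) ^ (n + 2) * b ^ k) *
              q ^ 2 := by ring
          _ = (c * q * r * b ^ (k + 1)) ^ 2 * t ^ (n + 2) * q ^ 2 := by
              rw [e]
  have hle : ∀ k, Metric.closedBall x (r * (1 - a / 2)) ⊆ Metric.closedBall x (Rad k) := by
    intro k
    refine Metric.closedBall_subset_closedBall (mul_le_mul_of_nonneg_left ?_ hr.le)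
    have := hpow k
    nlinarith
  have hall := ae_all_iff.2 fun k => ae_restrict_of_ae_restrict_of_subset (hle k) (hiter k)
  filter_upwards [hall] with z hz
  have hlim : Tendsto (fun k : ℕ => c * q * r * b ^ k) atTop (𝓝 0) := by
    simpa using (tendsto_pow_atTop_nhds_zero_of_lt_one hb0.le (by linarith)).const_mul (c * q * r)
  exact norm_le_zero_iff.1 (ge_of_tendsto' hlim hz)

/-! ### Pointwise values and nondegeneracy. -/

theorem closedBall_ae_eq_ball (x : E) {s : ℝ} (hs : 0 < s) :
    Metric.closedBall x s =ᵐ[volume] Metric.ball x s := by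
  refine (ae_eq_of_subset_of_measure_ge Metric.ball_subset_closedBall ?_
    measurableSet_ball.nullMeasurableSet measure_closedBall_lt_top.ne).symm
  rw [Measure.addHaar_closedBall _ _ hs.le, Measure.addHaar_ball_of_pos _ _ hs]

theorem version_ae_eq (hΩ : IsOpen Ω) (u : SobolevMap Ω m) :
    ∀ᵐ y ∂(volume.restrict Ω), version u y = u.val y := by
  have h : ∀ i, ∀ᵐ y ∂(volume.restrict Ω), version u y i = u.val y i := by
    intro i
    have hF : MemLp (Ω.indicator fun x => u.val x i) 2 volume :=
      (memLp_indicator_iff_restrict hΩ.measurableSet).2 (u.memLp_coord i)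
    have hli := hF.locallyIntegrable (by norm_num)
    filter_upwards [ae_restrict_of_ae (IsUnifLocDoublingMeasure.ae_tendsto_average
      (μ := (volume : Measure E)) hli 1), ae_restrict_mem hΩ.measurableSet] with y hy hyΩ
    have ht := hy (fun _ => y) (fun s : ℝ => s) (l := 𝓝[>] 0) tendsto_id (by
      filter_upwards [self_mem_nhdsWithin] with s hs
      simpa using (Set.mem_Ioi.1 hs).le)
    rw [Set.indicator_of_mem hyΩ] at ht
    obtain ⟨δ, hδ, hsub⟩ := Metric.isOpen_iff.1 hΩ y hyΩ
    refine Tendsto.limUnder_eq (ht.congr' ?_)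
    filter_upwards [Ioc_mem_nhdsGT hδ] with s hs
    rw [setAverage_congr (closedBall_ae_eq_ball y hs.1)]
    refine setAverage_congr_fun measurableSet_ball (Eventually.of_forall fun z hz => ?_)
    exact Set.indicator_of_mem (hsub (Metric.ball_subset_ball hs.2 hz)) _
  filter_upwards [ae_all_iff.2 h] with y hy
  ext i
  exact hy i

theorem version_eq_zero (u : SobolevMap Ω m) {y : E} {δ : ℝ} (hδ : 0 < δ)
    (h : ∀ᵐ z ∂(volume.restrict (Metric.ball y δ)), u.val z = 0) : version u y = 0 := by
  ext i
  refine Tendsto.limUnder_eq (tendsto_const_nhds.congr' ?_)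
  filter_upwards [Ioc_mem_nhdsGT hδ] with s hs
  have : ∀ᵐ z, z ∈ Metric.ball y s → u.val z i = 0 := by
    have h' := (ae_restrict_iff' measurableSet_ball).1
      (ae_restrict_of_ae_restrict_of_subset (Metric.ball_subset_ball hs.2) h)
    filter_upwards [h'] with z hz hzs
    rw [hz hzs]
    rfl
  rw [setAverage_congr_fun measurableSet_ball this, setAverage_eq]
  simp

/-- The dichotomy behind linear nondegeneracy, for maps that are minimal among cutoffs. -/
theorem exists_nondegeneracy_const (n : ℕ) : ∃ c : ℝ → ℝ, (∀ ρ : ℝ, ρ < 1 → 0 < c ρ) ∧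
    ∀ (m : ℕ) (Ω : Set (EuclideanSpace ℝ (Fin n))) (u : SobolevMap Ω m)
      (Q : EuclideanSpace ℝ (Fin n) → ℝ) (q : ℝ), IsOpen Ω → 0 < q →
      IntegrableOn (fun x => Q x ^ 2) Ω → (∀ᵐ x ∂(volume.restrict Ω), q ≤ Q x) →
      (∀ φ : EuclideanSpace ℝ (Fin n) → ℝ, ContDiff ℝ ∞ φ → HasCompactSupport φ →
        tsupport φ ⊆ Ω → u.firstVar φ = 0) →
      ∀ (x : EuclideanSpace ℝ (Fin n)) (r : ℝ), 0 < r → Metric.ball x r ⊆ Ω →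
      MinimizesCutoffs Q u x r q →
      ∀ ρ : ℝ, 0 < ρ → ρ < 1 →
        (closure (Metric.ball x (ρ * r)) ∩ {y | 0 < ‖version u y‖}).Nonempty →
        ENNReal.ofReal (c ρ * q * r) ≤ ⨆ y ∈ Metric.ball x r, ‖version u y‖ₑ := by
  obtain ⟨c, hc, hvan⟩ := exists_vanishing_const n
  refine ⟨c, hc, ?_⟩
  intro m Ω u Q q hΩ hq hQ hQq hvar x r hr hxr hmin ρ hρ0 hρ ⟨y, hy, hypos⟩
  by_contra! hlt
  have hb : ∀ᵐ z ∂(volume.restrict (Metric.ball x r)), ‖u.val z‖ ≤ c ρ * q * r := by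
    filter_upwards [ae_restrict_of_ae_restrict_of_subset hxr (version_ae_eq hΩ u),
      ae_restrict_mem measurableSet_ball] with z hz hzb
    have h1 : ‖version u z‖ₑ ≤ ENNReal.ofReal (c ρ * q * r) :=
      (le_iSup₂ (f := fun y (_ : y ∈ Metric.ball x r) => ‖version u y‖ₑ) z hzb).trans hlt.le
    rw [hz, ← ofReal_norm, ENNReal.ofReal_le_ofReal_iff
      (by have := hc ρ hρ; positivity)] at h1
    exact h1
  have hz := hvan m Ω u Q q hΩ hq hQ hQq hvar x r hr hxr hmin ρ hρ0 hρ hb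
  have hyr : dist y x ≤ ρ * r := Metric.mem_closedBall.1 (Metric.closure_ball_subset_closedBall hy)
  -- This is the gap between `ρ r` and the radius of the ball on which `u` vanishes a.e.; it gives
  -- `y`, even on the boundary of `B_{ρr}(x)`, a neighbourhood where `u = 0` a.e.
  have hδ : 0 < r * ((1 - ρ) / 2) := by
    have : 0 < 1 - ρ := by linarith
    positivity
  have h0 : version u y = 0 := version_eq_zero u hδ
    (ae_restrict_of_ae_restrict_of_subset (Metric.ball_subset_closedBall.trans
      (Metric.closedBall_subset_closedBall' (by linarith))) hz)
  simp [h0] at hypos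

end VectorBernoulli

end

theorem mainTheorem4 (n : ℕ) (hn : 1 ≤ n) :
    -- the constant depends only on `ρ` (in the fixed dimension `n`)
    ∃ c : ℝ → ℝ, (∀ ρ : ℝ, 0 < ρ → ρ < 1 → 0 < c ρ) ∧
      ∀ (m : ℕ) (_ : 1 ≤ m)
        (Ω : Set (EuclideanSpace ℝ (Fin n))) (_ : IsOpen Ω) (_ : IsConnected Ω)
        (_ : Bornology.IsBounded Ω)
        (Qmin Qmax : ℝ) (_ : 0 < Qmin) (_ : Qmin ≤ Qmax)
        (Q : EuclideanSpace ℝ (Fin n) → ℝ) (_ : AEMeasurable Q (volume.restrict Ω))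
        (_ : ∀ᵐ x ∂(volume.restrict Ω), Qmin ≤ Q x ∧ Q x ≤ Qmax)
        (g : VectorBernoulli.SobolevMap Ω m) (_ : VectorBernoulli.NonnegAE g)
        (u : VectorBernoulli.SobolevMap Ω m),
        -- absolute minimizers: all balls and all `ρ`
        (VectorBernoulli.IsAbsoluteMinimizer Q g u →
          ∀ (x : EuclideanSpace ℝ (Fin n)) (r : ℝ), 0 < r → Metric.ball x r ⊆ Ω →
          ∀ ρ : ℝ, 0 < ρ → ρ < 1 →
            (closure (Metric.ball x (ρ * r)) ∩
              {y | 0 < ‖VectorBernoulli.version u y‖}).Nonempty →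
            ENNReal.ofReal (c ρ * Qmin * r) ≤
              ⨆ y ∈ Metric.ball x r, ‖VectorBernoulli.version u y‖ₑ) ∧
        -- local minimizers: small balls, and small `ρ` if `n = 2`
        (VectorBernoulli.IsLocalMinimizer Q g u →
          ∃ r₀ ρ₀ : ℝ, 0 < r₀ ∧ 0 < ρ₀ ∧
          ∀ (x : EuclideanSpace ℝ (Fin n)) (r : ℝ), 0 < r → r ≤ r₀ → Metric.ball x r ⊆ Ω →
          ∀ ρ : ℝ, 0 < ρ → ρ < 1 → (n = 2 → ρ ≤ ρ₀) →
            (closure (Metric.ball x (ρ * r)) ∩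
              {y | 0 < ‖VectorBernoulli.version u y‖}).Nonempty →
            ENNReal.ofReal (c ρ * Qmin * r) ≤
              ⨆ y ∈ Metric.ball x r, ‖VectorBernoulli.version u y‖ₑ) := by
  obtain ⟨c, hc, hmain⟩ := VectorBernoulli.exists_nondegeneracy_const n
  refine ⟨c, fun ρ _ hρ => hc ρ hρ, ?_⟩
  intro m _ Ω hΩ _ hbdd Qmin Qmax hQ0 _ Q hQm hQb g _ u
  have hQ : IntegrableOn (fun x => Q x ^ 2) Ω := by
    refine Integrable.mono' (integrableOn_const (C := Qmax ^ 2) hbdd.measure_lt_top.ne)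
      (hQm.pow_const 2).aestronglyMeasurable ?_
    filter_upwards [hQb] with x hx
    rw [Real.norm_of_nonneg (sq_nonneg _)]
    exact pow_le_pow_left₀ (hQ0.le.trans hx.1) hx.2 2
  have hQq : ∀ᵐ x ∂(volume.restrict Ω), Qmin ≤ Q x := hQb.mono fun x hx => hx.1
  have hsub : ∀ {x : EuclideanSpace ℝ (Fin n)} {R r : ℝ} {φ : EuclideanSpace ℝ (Fin n) → ℝ},
      R < r → Metric.ball x r ⊆ Ω → (∀ z ∉ Metric.closedBall x R, φ z = 0) → tsupport φ ⊆ Ω :=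
    fun hRr hxr h0 => (VectorBernoulli.tsupport_subset_closedBall h0).trans
      ((Metric.closedBall_subset_ball hRr).trans hxr)
  constructor
  · intro hu x r hr hxr
    refine hmain m Ω u Q Qmin hΩ hQ0 hQ hQq
      (fun φ hφ hφc hs => hu.isLocalMinimizer.firstVar_eq_zero hΩ hQ hφ hφc hs) x r hr hxr ?_
    -- Absolute minimality admits every such cutoff, without smallness of the radius.
    intro R φ hφ hφc _ hRr h0 _ h1 _
    exact hu.2 _ (hu.1.mulCut hΩ hφ hφc (hsub hRr hxr h0) h1)
  · intro hu
    have hvar : ∀ φ : EuclideanSpace ℝ (Fin n) → ℝ, ContDiff ℝ ∞ φ → HasCompactSupport φ →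
        tsupport φ ⊆ Ω → u.firstVar φ = 0 :=
      fun φ hφ hφc hs => hu.firstVar_eq_zero hΩ hQ hφ hφc hs
    obtain ⟨hadm, ε, hε, hmin⟩ := hu
    obtain ⟨r₀, hr₀, hd⟩ := VectorBernoulli.exists_radius_metricD_lt hn hΩ u Qmin hε
    -- With `ρ₀ = 1` the extra condition for `n = 2` follows from `ρ < 1`; locality costs only the
    -- bound `r ≤ r₀`.
    refine ⟨r₀, 1, hr₀, one_pos, fun x r hr hrr₀ hxr ρ hρ0 hρ _ => ?_⟩
    refine hmain m Ω u Q Qmin hΩ hQ0 hQ hQq hvar x r hr hxr ?_ ρ hρ0 hρ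
    intro R φ hφ hφc hR0 hRr h0 hn0 h1 hq
    exact hmin _ (hadm.mulCut hΩ hφ hφc (hsub hRr hxr h0) h1)
      (hd x R hR0 (hRr.le.trans hrr₀) ((Metric.closedBall_subset_ball hRr).trans hxr)
        φ hφ hφc h0 hn0 h1 hq)
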